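/- Let $N$ be a number of players with strategies $x^k\in\mathbb R^{n_k}$, $x=(x^1,\dots,x^N)\in\mathbb R^{n}$, $n=\sum_k n_k$. For parameters $p=(p^1,\dots,p^N)$, $p^k=(u^k,v^k,w^k)\in\mathbb R^{m_k}\times\mathbb R^{n_k}\times\mathbb R^{d_k}$, let player $k$ solve, for given strategies $x^{-k}$ of the others, $$\min_{x^k\in\mathbb R^{n_k}}\ \tfrac12 x^{\mathrm T}P^k(w^k)x-\langle c^k(w^k),x\rangle-\langle v^k,x^k\rangle\quad\text{s.t.}\quad a^k_i(w^k)^{\mathrm T}x^k=b^k_i+u^k_i\ (i\le s_k),\quad a^k_i(w^k)^{\mathrm T}x^k\le b^k_i+u^k_i\ (s_k<i\le m_k),$$ where $0\le s_k\le m_k$, $P^k(\cdot)\in\mathbb R^{n\times n}$, $c^k(\cdot)\in\mathbb R^n$, $a^k_i(\cdot)\in\mathbb R^{n_k}$. With $L^k(x,\lambda^k;w^k)=\frac12 x^{\mathrm T}P^k(w^k)x-\langle c^k(w^k),x\rangle+\sum_i\lambda^k_i\,(a_i^k(w^k)^{\mathrm T}x^k-b_i^k)$ and $G^k(x^k;w^k)=(a^k_i(w^k)^{\mathrm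 T}x^k-b^k_i)_{i\le m_k}$, let $S_{\rm KKT}(p)$ be the set of all $(x,\lambda)$, $\lambda=(\lambda^1,\dots,\lambda^N)$, $\lambda^k\in\mathbb R^{m_k}$, such that for every $k$ $$v^k=\nabla_{x^k}L^k(x,\lambda^k;w^k),\qquad -u^k\in -G^k(x^k;w^k)+N_{\mathbb R^{s_k}\times\mathbb R_+^{m_k-s_k}}(\lambda^k),$$ where $N_C(\cdot)$ denotes the normal cone to $C$. Fix $\bar p=(\bar u,\bar v,\bar w)$ and $(\bar x,\bar\lambda)\in S_{\rm KKT}(\bar p)$. Assume that $P^k,c^k,a^k_i$ are continuously differentiable around $\bar w^k$ and that $P^k:=P^k(\bar w^k)$ is symmetric; denote its blocks by $P^k_{n_in_j}\in\mathbb R^{n_i\times n_j}$. Write $a_i^k=a_i^k(\bar w^k)$ and let $A^k$ be the matrix with rows $(a_i^k)^{\mathrm T}$. Let $$I_1^k=\{1,\dots,s_k\}\cup\{i>s_k:\bar\lambda^k_i>0=(a^k_i)^{\mathrm T}\bar x^k-b^k_i-\bar u^k_i\},\qquad I_2^k=\{i>s_k:\bar\lambda^k_i=0=(a^k_i)^{\mathrm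 T}\bar x^k-b^k_i-\bar u^k_i\},$$ let $A_1^k,A_2^k$ be the submatrices of $A^k$ of the rows in $I_1^k,I_2^k$, let $M^k=\{y\in\mathbb R^{n_k}:(a_i^k)^{\mathrm T}y=0\ \forall i\in I_1^k\}$, let $B^k$ be a matrix whose columns form a basis of $M^k$, and let $T_{ki}=P^k_{n_kn_i}+(P^i_{n_in_k})^{\mathrm T}$. Suppose that 1. $\begin{pmatrix}A_1^k\\A_2^k\end{pmatrix}$ has full row rank for every $k$; 2. $y^{\mathrm T}P^k_{n_kn_k}y>0$ for every $k$ and every $0\ne y\in M^k$; 3. there are numbers $\alpha_{i,j}>0$ ($i\neq j$) with $\sum_{j\ne i}\alpha_{i,j}=1$ for every $i$ such that for all players $i\neq k$ and all $0\neq y\in M^k$ $$y^{\mathrm T}\Big(P^k_{n_kn_k}-\frac1{4\alpha_{i,k}\alpha_{k,i}}\,T_{ik}^{\mathrm T}B^i\big((B^i)^{\mathrm T}P^i_{n_in_i}B^i\big)^{-1}(B^i)^{\mathrm T}T_{ik}\Big)y>0$$ (for $N=1$ condition 3 is void). Then $S_{\rm KKT}$ is strongly regular at $\bar p$ for $(\bar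 x,\bar\lambda)$, i.e. it has a Lipschitz continuous single-valued localization: there are neighborhoods $U$ of $\bar p$ and $V$ of $(\bar x,\bar\lambda)$ and a Lipschitz continuous $\varphi$ on $U$ with $S_{\rm KKT}(p)\cap V=\{\varphi(p)\}$ for all $p\in U$. Moreover, there is a neighborhood of $(\bar p,\bar x,\bar\lambda)$ such that for all $(p,x,\lambda)$ in it with $(x,\lambda)\in S_{\rm KKT}(p)$, the point $x$ is a local Nash equilibrium at $p$: each $x^k$ is a local minimizer of player $k$'s problem for the given $x^{-k}$ and $p^k$. -/

import Mathlib

open Filter Topology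

noncomputable section

namespace NashKKT

/-- `ℝⁿ` with the Euclidean norm. -/
abbrev E (n : ℕ) : Type := EuclideanSpace ℝ (Fin n)

/-- Strategy profiles `x = (x¹, …, x^N)` with `x^k ∈ ℝ^{n_k}`; multipliers `λ` have the same form. -/
abbrev Profile {N : ℕ} (n : Fin N → ℕ) : Type := ∀ k, E (n k)

/-- Perturbations `p = (p¹, …, p^N)` with `p^k = (u^k, v^k, w^k) ∈ ℝ^{m_k} × ℝ^{n_k} × ℝ^{d_k}`. -/
abbrev Param {N : ℕ} (n m d : Fin N → ℕ) : Type := ∀ k, E (m k) × E (n k) × E (d k)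

/-- The normal cone to a convex set `C` at `z` (empty when `z ∉ C`). -/
def normalCone {F : Type*} [NormedAddCommGroup F] [InnerProductSpace ℝ F] (C : Set F) (z : F) :
    Set F :=
  {ν | z ∈ C ∧ ∀ y ∈ C, inner ℝ ν (y - z) ≤ 0}

/-- The cone `ℝ^s × ℝ₊^{m-s}`. -/
def multiplierCone (m s : ℕ) : Set (E m) :=
  {l | ∀ i : Fin m, s ≤ (i : ℕ) → 0 ≤ l i}

/-- `Φ` is strongly regular at `a` for `b`: `b ∈ Φ a`, and near `(a, b)` the graph of `Φ` is the
graph of a Lipschitz continuous function defined on a neighborhood of `a`. -/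
def StronglyRegular {X Y : Type*} [PseudoMetricSpace X] [PseudoMetricSpace Y]
    (Φ : X → Set Y) (a : X) (b : Y) : Prop :=
  b ∈ Φ a ∧ ∃ U ∈ 𝓝 a, ∃ V ∈ 𝓝 b, ∃ φ : X → Y, ∃ K : NNReal,
    LipschitzOnWith K φ U ∧ ∀ x ∈ U, Φ x ∩ V = {φ x}

/-- The data of a Nash equilibrium problem with `N` players; in player `k`'s problem the
constraints with index `i < s k` are equalities and the other ones are inequalities. -/
structure NEP {N : ℕ} (n m d : Fin N → ℕ) where
  s : Fin N → ℕ
  s_le : ∀ k, s k ≤ m k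
  /-- the objective `f^k(x; w^k)` -/
  f : ∀ k, Profile n → E (d k) → ℝ
  /-- the constraint functions `g^k_i(x^k; w^k)` -/
  g : ∀ k, Fin (m k) → E (n k) → E (d k) → ℝ

namespace NEP

variable {N : ℕ} {n m d : Fin N → ℕ} (G : NEP n m d)

/-- The feasible set of player `k` at the perturbation `p`. -/
def feasible (p : Param n m d) (k : Fin N) : Set (E (n k)) :=
  {y | (∀ i : Fin (m k), (i : ℕ) < G.s k → G.g k i y (p k).2.2 = (p k).1 i) ∧
    ∀ i : Fin (m k), G.s k ≤ (i : ℕ) → G.g k i y (p k).2.2 ≤ (p k).1 i}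

/-- The objective of player `k` as a function of the own strategy `y`, the other strategies being
those of `x`, at the perturbation `p`. -/
def playerObjective (p : Param n m d) (x : Profile n) (k : Fin N) (y : E (n k)) : ℝ :=
  G.f k (Function.update x k y) (p k).2.2 - inner ℝ (p k).2.1 y

/-- Local Nash equilibrium at `p`: each `x^k` is a local minimizer of player `k`'s problem. -/
def IsLNE (p : Param n m d) (x : Profile n) : Prop :=
  ∀ k, x k ∈ G.feasible p k ∧ IsLocalMinOn (G.playerObjective p x k) (G.feasible p k) (x k)

/-- The Lagrange function `L^k(x, λ^k; w^k)`. -/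
def lagrangian (k : Fin N) (x : Profile n) (l : E (m k)) (w : E (d k)) : ℝ :=
  G.f k x w + ∑ i, l i * G.g k i (x k) w

/-- The partial gradient `∇_{x^k} L^k(x, λ^k; w^k)`. -/
def gradLagrangian (k : Fin N) (x : Profile n) (l : E (m k)) (w : E (d k)) : E (n k) :=
  gradient (fun y => G.lagrangian k (Function.update x k y) l w) (x k)

/-- The constraint vector `G^k(x^k; w^k)`. -/
def constraintVec (k : Fin N) (y : E (n k)) (w : E (d k)) : E (m k) :=
  WithLp.toLp 2 fun i => G.g k i y w

/-- The KKT solution mapping `S_KKT`: the pairs `(x, λ)` with `v^k = ∇_{x^k} L^k` and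
`-u^k ∈ -G^k + N(λ^k)` for each player `k`. -/
def SKKT (p : Param n m d) : Set (Profile n × Profile m) :=
  {z | ∀ k, (p k).2.1 = G.gradLagrangian k z.1 (z.2 k) (p k).2.2 ∧
    ∃ ν ∈ normalCone (multiplierCone (m k) (G.s k)) (z.2 k),
      -(p k).1 = -G.constraintVec k (z.1 k) (p k).2.2 + ν}

/-- The index set `I₁^k` of equality constraints and strongly active inequality constraints. -/
def I₁ (p : Param n m d) (x : Profile n) (l : Profile m) (k : Fin N) : Set (Fin (m k)) :=
  {i | (i : ℕ) < G.s k} ∪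
    {i | G.s k ≤ (i : ℕ) ∧ 0 < l k i ∧ G.g k i (x k) (p k).2.2 - (p k).1 i = 0}

/-- The index set `I₂^k` of weakly active inequality constraints. -/
def I₂ (p : Param n m d) (x : Profile n) (l : Profile m) (k : Fin N) : Set (Fin (m k)) :=
  {i | G.s k ≤ (i : ℕ) ∧ l k i = 0 ∧ G.g k i (x k) (p k).2.2 - (p k).1 i = 0}

end NEP

/-- The data of a Nash equilibrium problem in which player `k` minimizes
`½ xᵀ P^k(w^k) x - ⟨c^k(w^k), x⟩ - ⟨v^k, x^k⟩` over `x^k`, subject to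
`a_i^k(w^k)ᵀ x^k = b_i^k + u_i^k` for the first `s k` indices `i` and to
`a_i^k(w^k)ᵀ x^k ≤ b_i^k + u_i^k` for the others. -/
structure QPData {N : ℕ} (n m d : Fin N → ℕ) where
  s : Fin N → ℕ
  s_le : ∀ k, s k ≤ m k
  P : ∀ k, E (d k) → Matrix (Σ j, Fin (n j)) (Σ j, Fin (n j)) ℝ
  c : ∀ k, E (d k) → EuclideanSpace ℝ (Σ j, Fin (n j))
  a : ∀ k, Fin (m k) → E (d k) → E (n k)
  b : ∀ k, Fin (m k) → ℝ

/-- A profile as a single vector of `ℝ^{n_1 + ⋯ + n_N}`. -/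
def stack {N : ℕ} {n : Fin N → ℕ} (x : Profile n) : (Σ j, Fin (n j)) → ℝ :=
  fun i => x i.1 i.2

namespace QPData

variable {N : ℕ} {n m d : Fin N → ℕ} (Q : QPData n m d)

/-- The Nash equilibrium problem given by quadratic programming data. -/
def toNEP : NEP n m d where
  s := Q.s
  s_le := Q.s_le
  f k x w := 1 / 2 * (stack x ⬝ᵥ (Q.P k w).mulVec (stack x)) - (Q.c k w).ofLp ⬝ᵥ stack x
  g k i y w := (Q.a k i w).ofLp ⬝ᵥ y.ofLp - Q.b k i

/-- `P^k, c^k, a_i^k` are continuously differentiable around `w`. -/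
def SmoothAt (w : ∀ k, E (d k)) : Prop :=
  ∀ k, (∀ i j, ContDiffAt ℝ 1 (fun w' => Q.P k w' i j) (w k)) ∧
    ContDiffAt ℝ 1 (Q.c k) (w k) ∧ ∀ i, ContDiffAt ℝ 1 (Q.a k i) (w k)

/-- The matrix `A^k` with rows `(a_i^k)ᵀ` at `w^k`. -/
def A (k : Fin N) (w : E (d k)) : Matrix (Fin (m k)) (Fin (n k)) ℝ :=
  Matrix.of fun i j => Q.a k i w j

/-- The block `P^k_{n_i n_j}` of `P^k` at `w^k`. -/
def block (k : Fin N) (w : E (d k)) (i j : Fin N) : Matrix (Fin (n i)) (Fin (n j)) ℝ :=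
  (Q.P k w).submatrix (fun e => ⟨i, e⟩) (fun e => ⟨j, e⟩)

/-- `T_{ki} = P^k_{n_k n_i} + (P^i_{n_i n_k})ᵀ`. -/
def T (w : ∀ k, E (d k)) (k i : Fin N) : Matrix (Fin (n k)) (Fin (n i)) ℝ :=
  Q.block k (w k) k i + (Q.block i (w i) i k).transpose

/-- The subspace `M^k = {y | (a_i^k)ᵀ y = 0 for all i ∈ I₁^k}`. -/
def M (p : Param n m d) (x : Profile n) (l : Profile m) (k : Fin N) :
    Submodule ℝ (Fin (n k) → ℝ) where
  carrier := {y | ∀ i ∈ Q.toNEP.I₁ p x l k, Q.A k (p k).2.2 i ⬝ᵥ y = 0}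
  add_mem' := by
    intro y z hy hz i hi
    rw [dotProduct_add, hy i hi, hz i hi, add_zero]
  zero_mem' := fun i _ => dotProduct_zero _
  smul_mem' := by
    intro t y hy i hi
    rw [dotProduct_smul, hy i hi, smul_zero]

end QPData

end NashKKT

end

open NashKKT

/-! Near the reference point, strongly active inequalities keep positive multipliers, hence stay
active, and inactive ones stay inactive. Only the weakly active constraints in `I₂` keep a genuine
complementarity condition. Locally the KKT system is therefore linear in `(x, λ)`, coupled to a
linear complementarity problem (LCP) for the multipliers of `I₂` (`mem_SKKT_iff_mixedLCP`).
Eliminating `(x, λ)` leaves an LCP with matrix `S p`. If `S p₀` is positive definite, symmetric or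
not, the solution exists, is unique and is Lipschitz in the data (`exists_lipschitzOn_mixedLCP`).

Positive definiteness of `S p₀` comes from the linearized stationarity equation. Paired with `x`, it
gives `∑ x^k · (A^k)ᵀ λ^k = -∑ x^k · P^k_{n_k n_i} x^i`, and the right side is negative when the
game Jacobian is positive definite on the product of the `M^k`; independence of the active rows
excludes `x = 0`, `λ ≠ 0` (`inner_constraintOperator_neg`). Conditions 2 and 3 provide this
definiteness: the weights `α` split the quadratic form into forms on pairs of players, each
controlled by a Schur complement (`sum_dotProduct_mulVec_pos`).

For local optimality only condition 2 is needed. By Finsler's lemma a multiple of the squared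
strongly active gradients makes each own Hessian positive, and this persists nearby. For short
feasible steps the multiplier terms absorb that penalty (`eventually_isLNE`). -/

/-- A family of continuous linear maps on a finite-dimensional space that is `C^k` at a point
pointwise is `C^k` there. -/
theorem contDiffAt_clm_of_apply {D E F : Type*} [NormedAddCommGroup D] [NormedSpace ℝ D]
    [NormedAddCommGroup E] [NormedSpace ℝ E] [NormedAddCommGroup F] [NormedSpace ℝ F]
    [FiniteDimensional ℝ E] {k : WithTop ℕ∞} {f : D → E →L[ℝ] F} {a : D}
    (h : ∀ y, ContDiffAt ℝ k (fun x => f x y) a) : ContDiffAt ℝ k f a := by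
  let e₁ := ContinuousLinearEquiv.ofFinrankEq
    (Module.finrank_fin_fun ℝ (n := Module.finrank ℝ E)).symm
  -- `e₂` identifies a linear map with the tuple of its values on a basis.
  let e₂ := (e₁.arrowCongr (1 : F ≃L[ℝ] F)).trans
    (ContinuousLinearEquiv.piRing (Fin (Module.finrank ℝ E)))
  rw [← Function.id_comp f, ← e₂.symm_comp_self]
  exact e₂.symm.contDiff.contDiffAt.comp a (contDiffAt_pi.mpr fun i => h _)

/-! ### Linear complementarity problems with coercive matrix. -/

/-- `μ` solves the linear complementarity problem `0 ≤ μ ⊥ S μ + q ≥ 0`. -/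
def IsLCPSolution {ι : Type*} [Fintype ι] (S : EuclideanSpace ℝ ι →L[ℝ] EuclideanSpace ℝ ι)
    (q μ : EuclideanSpace ℝ ι) : Prop :=
  ∀ i, 0 ≤ μ i ∧ 0 ≤ (S μ + q) i ∧ μ i * (S μ + q) i = 0

section LCP

variable {ι : Type*} [Fintype ι] {S S' : EuclideanSpace ℝ ι →L[ℝ] EuclideanSpace ℝ ι}
  {q q' μ μ' : EuclideanSpace ℝ ι} {c : ℝ}

/-- Monotonicity: with slacks `y = S μ + q` and `y' = S' μ' + q'`, complementarity reduces `(μ i -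
μ' i) * (y i - y' i)` to `-(μ i * y' i + μ' i * y i) ≤ 0`. Coercivity of `S` alone suffices.
Uniqueness, boundedness and Lipschitz dependence all follow from this estimate. -/
theorem IsLCPSolution.norm_sub_le (hc : ∀ x, c * ‖x‖ ^ 2 ≤ inner ℝ (S x) x)
    (h : IsLCPSolution S q μ) (h' : IsLCPSolution S' q' μ') :
    c * ‖μ - μ'‖ ≤ ‖S - S'‖ * ‖μ'‖ + ‖q - q'‖ := by
  have key : inner ℝ ((S μ + q) - (S' μ' + q')) (μ - μ') ≤ 0 := by
    rw [PiLp.inner_apply]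
    refine Finset.sum_nonpos fun i _ => ?_
    obtain ⟨a1, a2, a3⟩ := h i
    obtain ⟨b1, b2, b3⟩ := h' i
    have e : inner ℝ (((S μ + q) - (S' μ' + q')) i) ((μ - μ') i)
        = (μ i - μ' i) * ((S μ + q) i - (S' μ' + q') i) := rfl
    rw [e]
    nlinarith [mul_nonneg a1 b2, mul_nonneg b1 a2]
  have e : (S μ + q) - (S' μ' + q') = S (μ - μ') + ((S - S') μ' + (q - q')) := by
    rw [map_sub, _root_.sub_apply]; abel
  rw [e, inner_add_left] at key
  have h1 := hc (μ - μ')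
  have h2 := neg_le_of_abs_le
    (abs_real_inner_le_norm ((S - S') μ' + (q - q')) (μ - μ'))
  have h3 : ‖(S - S') μ' + (q - q')‖ ≤ ‖S - S'‖ * ‖μ'‖ + ‖q - q'‖ :=
    (norm_add_le _ _).trans (add_le_add_left ((S - S').le_opNorm μ') _)
  rcases (norm_nonneg (μ - μ')).eq_or_lt with h0 | h0
  · rw [← h0, mul_zero]; positivity
  · refine le_of_mul_le_mul_right ?_ h0
    nlinarith [mul_le_mul_of_nonneg_right h3 h0.le]

/-- Solutions are the fixed points of the projected step `μ ↦ max (μ - τ (S μ + q)) 0`. Projection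
is nonexpansive and `‖x - τ S x‖² ≤ (1 - 2 τ c + τ² L²) ‖x‖²`; `τ = c / L²` minimizes the factor,
giving `1 - c² / L² < 1`. Taking `L = ‖S‖ + c` ensures both `L > 0` and `c ≤ L`. -/
theorem exists_isLCPSolution (hc0 : 0 < c) (hc : ∀ x, c * ‖x‖ ^ 2 ≤ inner ℝ (S x) x)
    (q : EuclideanSpace ℝ ι) : ∃ μ, IsLCPSolution S q μ := by
  set L := ‖S‖ + c with hL
  have hLpos : 0 < L := by positivity
  set τ := c / L ^ 2 with hτ
  have hτpos : 0 < τ := by positivity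
  let T : EuclideanSpace ℝ ι → EuclideanSpace ℝ ι := fun μ =>
    WithLp.toLp 2 fun i => max (μ i - τ * (S μ + q) i) 0
  have hcL : c ≤ L := by rw [hL]; linarith [norm_nonneg S]
  have hK : 0 ≤ 1 - c ^ 2 / L ^ 2 := by
    rw [sub_nonneg, div_le_one (by positivity)]
    exact pow_le_pow_left₀ hc0.le hcL 2
  have hT : ∀ x y, dist (T x) (T y) ≤ √(1 - c ^ 2 / L ^ 2) * dist x y := by
    intro x y
    rw [dist_eq_norm, dist_eq_norm]
    have h1 : ‖T x - T y‖ ≤ ‖(x - y) - τ • S (x - y)‖ := by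
      rw [EuclideanSpace.norm_eq, EuclideanSpace.norm_eq]
      refine Real.sqrt_le_sqrt (Finset.sum_le_sum fun i _ => ?_)
      refine pow_le_pow_left₀ (norm_nonneg _) ?_ 2
      have e : ((x - y) - τ • S (x - y)) i
          = (x i - τ * (S x + q) i) - (y i - τ * (S y + q) i) := by
        simp only [map_sub, PiLp.sub_apply, PiLp.smul_apply, PiLp.add_apply, smul_eq_mul]; ring
      rw [e]
      exact abs_max_sub_max_le_abs _ _ _
    refine h1.trans (abs_le_of_sq_le_sq' ?_ (by positivity)).2
    rw [mul_pow, Real.sq_sqrt hK, norm_sub_sq_real, norm_smul, real_inner_smul_right,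
      real_inner_comm, Real.norm_of_nonneg hτpos.le, mul_pow]
    have h2 := mul_le_mul_of_nonneg_left (hc (x - y)) hτpos.le
    have h3 : ‖S (x - y)‖ ^ 2 ≤ (L * ‖x - y‖) ^ 2 :=
      pow_le_pow_left₀ (norm_nonneg _) ((S.le_opNorm _).trans
        (mul_le_mul_of_nonneg_right (by rw [hL]; linarith) (norm_nonneg _))) 2
    have h4 := mul_le_mul_of_nonneg_left h3 (sq_nonneg τ)
    have e1 : τ ^ 2 * (L * ‖x - y‖) ^ 2 = c ^ 2 / L ^ 2 * ‖x - y‖ ^ 2 := by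
      rw [hτ]; field_simp
    have e2 : τ * (c * ‖x - y‖ ^ 2) = c ^ 2 / L ^ 2 * ‖x - y‖ ^ 2 := by
      rw [hτ]; field_simp
    rw [e1] at h4
    rw [e2] at h2
    linarith
  have hcontr : ContractingWith (√(1 - c ^ 2 / L ^ 2)).toNNReal T := by
    refine ⟨?_, LipschitzWith.of_dist_le_mul fun x y => ?_⟩
    swap
    · rw [Real.coe_toNNReal _ (Real.sqrt_nonneg _)]; exact hT x y
    rw [Real.toNNReal_lt_one, Real.sqrt_lt' one_pos]
    have : 0 < c ^ 2 / L ^ 2 := by positivity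
    linarith
  refine ⟨ContractingWith.fixedPoint T hcontr, fun i => ?_⟩
  set μ := ContractingWith.fixedPoint T hcontr
  have hfix : T μ = μ := hcontr.fixedPoint_isFixedPt
  have hi : max (μ i - τ * (S μ + q) i) 0 = μ i := congrArg (fun z => z.ofLp i) hfix
  rcases le_total (μ i - τ * (S μ + q) i) 0 with h | h
  · rw [max_eq_right h] at hi
    rw [← hi] at h ⊢
    refine ⟨le_rfl, ?_, zero_mul _⟩
    exact nonneg_of_mul_nonneg_right (by linarith) hτpos
  · rw [max_eq_left h] at hi
    have h0 : (S μ + q) i = 0 := by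
      have : τ * (S μ + q) i = 0 := by linarith
      exact (mul_eq_zero.mp this).resolve_left hτpos.ne'
    rw [h0] at h ⊢
    exact ⟨by linarith, le_rfl, mul_zero _⟩

end LCP

theorem exists_coercive_of_pos {E : Type*} [NormedAddCommGroup E] [InnerProductSpace ℝ E]
    [FiniteDimensional ℝ E] {S : E →L[ℝ] E} (hS : ∀ x, x ≠ 0 → 0 < inner ℝ (S x) x) :
    ∃ c > 0, ∀ x, c * ‖x‖ ^ 2 ≤ inner ℝ (S x) x := by
  have hK : IsCompact (Metric.sphere (0 : E) 1) := isCompact_sphere 0 1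
  have hcont : ContinuousOn (fun x => inner ℝ (S x) x) (Metric.sphere (0 : E) 1) := by fun_prop
  obtain ⟨c, hc, h⟩ := hK.exists_forall_le' hcont (a := 0) fun x hx => hS x (by
    rintro rfl; simp at hx)
  refine ⟨c, hc, fun x => ?_⟩
  rcases eq_or_ne x 0 with rfl | hx
  · simp
  have hn : 0 < ‖x‖ := norm_pos_iff.mpr hx
  have := h (‖x‖⁻¹ • x) (by simp [norm_smul, hn.ne'])
  simp only [map_smul, real_inner_smul_left, real_inner_smul_right] at this
  calc c * ‖x‖ ^ 2 ≤ ‖x‖⁻¹ * (‖x‖⁻¹ * inner ℝ (S x) x) * ‖x‖ ^ 2 := by gcongr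
    _ = inner ℝ (S x) x := by field_simp

/-- The solution of a linear complementarity problem with a positive definite matrix is unique and
depends Lipschitz continuously on the data. -/
theorem exists_lipschitzOn_lcpSolution {ι : Type*} [Fintype ι]
    {S₀ : EuclideanSpace ℝ ι →L[ℝ] EuclideanSpace ℝ ι} (hS : ∀ x, x ≠ 0 → 0 < inner ℝ (S₀ x) x)
    (q₀ : EuclideanSpace ℝ ι) :
    ∃ U ∈ 𝓝 (S₀, q₀), ∃ ψ : (EuclideanSpace ℝ ι →L[ℝ] EuclideanSpace ℝ ι) ×
      EuclideanSpace ℝ ι → EuclideanSpace ℝ ι, ∃ K : NNReal, LipschitzOnWith K ψ U ∧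
      ∀ t ∈ U, ∀ μ, IsLCPSolution t.1 t.2 μ ↔ μ = ψ t := by
  classical
  obtain ⟨c, hc, hcS⟩ := exists_coercive_of_pos hS
  -- Perturbing `S₀` by less than `c / 2` in norm leaves the coercivity constant `c / 2`.
  have hc2 : 0 < c / 2 := half_pos hc
  set U := Metric.ball S₀ (c / 2) ×ˢ Metric.ball q₀ 1 with hU
  have hco : ∀ t ∈ U, ∀ x, c / 2 * ‖x‖ ^ 2 ≤ inner ℝ (t.1 x) x := by
    rintro ⟨S, q⟩ ⟨h, -⟩ x
    rw [mem_ball_iff_norm] at h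
    have h1 : |inner ℝ ((S - S₀) x) x| ≤ c / 2 * ‖x‖ ^ 2 := by
      refine (abs_real_inner_le_norm _ _).trans ?_
      rw [pow_two, ← mul_assoc]
      exact mul_le_mul_of_nonneg_right (((S - S₀).le_opNorm x).trans
        (mul_le_mul_of_nonneg_right h.le (norm_nonneg x))) (norm_nonneg x)
    rw [_root_.sub_apply, inner_sub_left] at h1
    have := hcS x
    have := (abs_le.mp h1).1
    dsimp only
    linarith
  have hex : ∀ t : (EuclideanSpace ℝ ι →L[ℝ] EuclideanSpace ℝ ι) × EuclideanSpace ℝ ι,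
      ∃ μ, t ∈ U → IsLCPSolution t.1 t.2 μ := fun t => by
    by_cases ht : t ∈ U
    · obtain ⟨μ, hμ⟩ := exists_isLCPSolution hc2 (hco t ht) t.2
      exact ⟨μ, fun _ => hμ⟩
    · exact ⟨0, fun h => absurd h ht⟩
  choose ψ hψ using hex
  -- Comparison with the trivial solution for `q = 0` bounds `ψ` on `U`; the bound is needed since
  -- the perturbation estimate contains the factor `‖μ'‖`.
  have hzero : ∀ S : EuclideanSpace ℝ ι →L[ℝ] EuclideanSpace ℝ ι, IsLCPSolution S 0 0 :=
    fun S i => by simp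
  have hbound : ∀ t ∈ U, ‖ψ t‖ ≤ (‖q₀‖ + 1) / (c / 2) := by
    intro t ht
    have h := (hψ t ht).norm_sub_le (hco t ht) (hzero t.1)
    have hq : ‖t.2‖ ≤ ‖q₀‖ + 1 := by
      have h2 := mem_ball_iff_norm.mp ht.2
      have h3 := norm_sub_norm_le t.2 q₀
      linarith
    rw [le_div_iff₀ hc2]
    simp only [sub_zero, sub_self, norm_zero, zero_mul, zero_add] at h
    linarith
  set R := (‖q₀‖ + 1) / (c / 2)
  have hR : 0 ≤ R := by positivity
  refine ⟨U, prod_mem_nhds (Metric.ball_mem_nhds _ hc2) (Metric.ball_mem_nhds _ one_pos), ψ,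
    ⟨(R + 1) / (c / 2), by positivity⟩, ?_, ?_⟩
  · refine LipschitzOnWith.of_dist_le_mul fun t ht t' ht' => ?_
    have h := (hψ t ht).norm_sub_le (hco t ht) (hψ t' ht')
    have hd1 : ‖t.1 - t'.1‖ ≤ dist t t' := by
      rw [← dist_eq_norm, Prod.dist_eq]; exact le_max_left _ _
    have hd2 : ‖t.2 - t'.2‖ ≤ dist t t' := by
      rw [← dist_eq_norm, Prod.dist_eq]; exact le_max_right _ _
    rw [dist_eq_norm]
    change _ ≤ (R + 1) / (c / 2) * dist t t'
    rw [div_mul_eq_mul_div, le_div_iff₀ hc2]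
    have := mul_le_mul hd1 (hbound t' ht') (norm_nonneg _) dist_nonneg
    linarith
  · refine fun t ht μ => ⟨fun h => ?_, fun h => h ▸ hψ t ht⟩
    have h' := h.norm_sub_le (hco t ht) (hψ t ht)
    rw [sub_self, sub_self, norm_zero, norm_zero, zero_mul, zero_add] at h'
    have : ‖μ - ψ t‖ ≤ 0 := nonpos_of_mul_nonpos_right h' hc2
    exact sub_eq_zero.mp (norm_le_zero_iff.mp this)

/-! ### Mixed complementarity problems: elimination of the linear unknowns. -/

/-- A parametric mixed linear complementarity problem: the linear equations `T p z = r p + J μ`,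
complementarity of `μ` and `h p - Γ p z`. Under a positivity condition at the reference parameter
it has, for nearby parameters, a unique solution, which is Lipschitz continuous. -/
theorem exists_lipschitzOn_mixedLCP {D Z ι : Type*} [NormedAddCommGroup D] [NormedSpace ℝ D]
    [NormedAddCommGroup Z] [NormedSpace ℝ Z] [FiniteDimensional ℝ Z] [Fintype ι]
    {T : D → Z →L[ℝ] Z} {r : D → Z} (J : EuclideanSpace ℝ ι →L[ℝ] Z)
    {Γ : D → Z →L[ℝ] EuclideanSpace ℝ ι} {h : D → EuclideanSpace ℝ ι} {p₀ : D}
    (hT : ContDiffAt ℝ 1 T p₀) (hr : ContDiffAt ℝ 1 r p₀) (hΓ : ContDiffAt ℝ 1 Γ p₀)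
    (hh : ContDiffAt ℝ 1 h p₀) (hinj : ∀ z, T p₀ z = 0 → z = 0)
    (hpos : ∀ z μ, T p₀ z = J μ → μ ≠ 0 → inner ℝ (Γ p₀ z) μ < 0) :
    ∃ U ∈ 𝓝 p₀, ∃ φ : D → Z, ∃ K : NNReal, LipschitzOnWith K φ U ∧ ∀ p ∈ U, ∀ z,
      (∃ μ, T p z = r p + J μ ∧
        ∀ i, 0 ≤ μ i ∧ 0 ≤ (h p - Γ p z) i ∧ μ i * (h p - Γ p z) i = 0) ↔ z = φ p := by
  have : CompleteSpace Z := FiniteDimensional.complete ℝ Z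
  have hinj' : Function.Injective (T p₀ : Z →ₗ[ℝ] Z) :=
    (injective_iff_map_eq_zero (T p₀ : Z →ₗ[ℝ] Z)).mpr hinj
  let e : Z ≃L[ℝ] Z := (LinearEquiv.ofInjectiveEndo (T p₀ : Z →ₗ[ℝ] Z) hinj').toContinuousLinearEquiv
  have he : (e : Z →L[ℝ] Z) = T p₀ := by ext z; rfl
  -- `inverse` is total, with value `0` at non-invertible maps; it is smooth near the invertible `T
  -- p₀`, and invertibility persists on a neighborhood (`hunit`).
  let V : D → Z →L[ℝ] Z := fun p => (T p).inverse
  have hV : ContDiffAt ℝ 1 V p₀ :=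
    ContDiffAt.comp p₀ (g := ContinuousLinearMap.inverse) (by
      rw [← he]; exact contDiffAt_map_inverse e) hT
  have hunit : ∀ᶠ p in 𝓝 p₀, ∃ e' : Z ≃L[ℝ] Z, (e' : Z →L[ℝ] Z) = T p := by
    have := hT.continuousAt.eventually (p := fun A => A ∈ Set.range ((↑) : (Z ≃L[ℝ] Z) → Z →L[ℝ] Z))
      (by rw [← he]; exact ContinuousLinearEquiv.nhds e)
    exact this
  have hVT : ∀ p, (∃ e' : Z ≃L[ℝ] Z, (e' : Z →L[ℝ] Z) = T p) →
      ∀ z y, T p z = y ↔ z = V p y := by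
    rintro p ⟨e', he'⟩ z y
    have : V p = e'.symm := by
      simp only [V, ← he']; exact ContinuousLinearMap.inverse_equiv e'
    rw [this, ← he']
    exact e'.eq_symm_apply.symm
  -- Substituting `z = V p (r p + J μ)` turns the slack `h p - Γ p z` into `S p μ + q p`.
  let S : D → EuclideanSpace ℝ ι →L[ℝ] EuclideanSpace ℝ ι := fun p => -((Γ p).comp ((V p).comp J))
  let q : D → EuclideanSpace ℝ ι := fun p => h p - Γ p (V p (r p))
  have hS : ContDiffAt ℝ 1 S p₀ := (hΓ.clm_comp (hV.clm_comp contDiffAt_const)).neg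
  have hq : ContDiffAt ℝ 1 q p₀ := hh.sub (hΓ.clm_apply (hV.clm_apply hr))
  have hS0 : ∀ μ, μ ≠ 0 → 0 < inner ℝ (S p₀ μ) μ := by
    intro μ hμ
    have := hpos (V p₀ (J μ)) μ (((hVT p₀ ⟨e, he⟩) _ _).mpr rfl) hμ
    simpa [S, inner_neg_left] using this
  obtain ⟨W, hW, ψ, K₁, hψ, hsol⟩ := exists_lipschitzOn_lcpSolution hS0 (q p₀)
  obtain ⟨K₂, U₂, hU₂, hL₂⟩ := (hS.prodMk hq).exists_lipschitzOnWith
  let μ₀ := ψ (S p₀, q p₀)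
  -- `ψ` is only Lipschitz, so `z` is treated as a `C¹` function of `(p, μ)` composed with the
  -- Lipschitz map `p ↦ (p, ψ (S p, q p))`.
  have hZ : ContDiffAt ℝ 1 (fun t : D × EuclideanSpace ℝ ι => V t.1 (r t.1 + J t.2)) (p₀, μ₀) := by
    have h1 : ContDiffAt ℝ 1 (Prod.fst : D × EuclideanSpace ℝ ι → D) (p₀, μ₀) := contDiffAt_fst
    have h2 : ContDiffAt ℝ 1 (fun t : D × EuclideanSpace ℝ ι => J t.2) (p₀, μ₀) :=
      J.contDiff.contDiffAt.comp _ contDiffAt_snd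
    exact (ContDiffAt.comp (p₀, μ₀) (g := V) hV h1).clm_apply
      ((ContDiffAt.comp (p₀, μ₀) (g := r) hr h1).add h2)
  obtain ⟨K₃, U₃, hU₃, hL₃⟩ := hZ.exists_lipschitzOnWith
  have hWpre : ∀ᶠ p in 𝓝 p₀, (S p, q p) ∈ W :=
    (hS.continuousAt.prodMk hq.continuousAt).eventually hW
  let U₄ := U₂ ∩ {p | (S p, q p) ∈ W}
  have hU₄ : U₄ ∈ 𝓝 p₀ := inter_mem hU₂ hWpre
  have hL₄ : LipschitzOnWith (max 1 (K₁ * K₂)) (fun p => (p, ψ (S p, q p))) U₄ :=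
    (LipschitzWith.id.lipschitzOnWith).prodMk
      (hψ.comp (hL₂.mono Set.inter_subset_left) fun p hp => hp.2)
  have hc₄ : ContinuousAt (fun p => (p, ψ (S p, q p))) p₀ := hL₄.continuousOn.continuousAt hU₄
  let U := U₄ ∩ {p | (p, ψ (S p, q p)) ∈ U₃} ∩ {p | ∃ e' : Z ≃L[ℝ] Z, (e' : Z →L[ℝ] Z) = T p}
  refine ⟨U, inter_mem (inter_mem hU₄ (hc₄.eventually hU₃)) hunit,
    fun p => V p (r p + J (ψ (S p, q p))), K₃ * max 1 (K₁ * K₂), ?_, ?_⟩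
  · exact hL₃.comp (f := fun p => (p, ψ (S p, q p))) (hL₄.mono fun p hp => hp.1.1)
      fun p hp => hp.1.2
  · rintro p ⟨⟨⟨hp2, hpW⟩, hp3⟩, hpe⟩ z
    have key : ∀ μ, T p z = r p + J μ → h p - Γ p z = S p μ + q p := by
      intro μ hμ
      rw [(hVT p hpe _ _).mp hμ]
      simp only [S, q, map_add, _root_.neg_apply, ContinuousLinearMap.comp_apply]
      abel
    constructor
    · rintro ⟨μ, hμ, hc⟩
      rw [key μ hμ] at hc
      rw [(hVT p hpe _ _).mp hμ, (hsol _ hpW μ).mp hc]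
    · rintro rfl
      have hz := (hVT p hpe _ _).mpr (rfl : V p (r p + J (ψ (S p, q p))) = _)
      refine ⟨ψ (S p, q p), hz, ?_⟩
      have hc := (hsol _ hpW _).mpr rfl
      have key' : h p - Γ p (V p (r p + J (ψ (S p, q p)))) = S p (ψ (S p, q p)) + q p := by
        simp only [S, q, map_add, _root_.neg_apply, ContinuousLinearMap.comp_apply]
        abel
      rw [key']
      exact hc

/-! ### The KKT conditions in coordinates. -/

noncomputable section KKT

open scoped Matrix

/-- The cone is a product of lines and half-lines, so displacements of a single coordinate are
enough as test vectors. -/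
theorem mem_normalCone_multiplierCone_iff {m s : ℕ} {ν z : E m} :
    ν ∈ normalCone (multiplierCone m s) z ↔
      ∀ i : Fin m, ((i : ℕ) < s → ν i = 0) ∧ (s ≤ (i : ℕ) → 0 ≤ z i ∧ ν i ≤ 0 ∧ z i * ν i = 0) := by
  constructor
  · rintro ⟨hz, h⟩ i
    have test : ∀ t : ℝ, (s ≤ (i : ℕ) → 0 ≤ z i + t) → t * ν i ≤ 0 := by
      intro t ht
      have := h (z + EuclideanSpace.single i t) fun j hj => by
        rcases eq_or_ne j i with rfl | hne
        · simpa using ht hj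
        · simpa [hne] using hz j hj
      simpa [EuclideanSpace.inner_single_right] using this
    constructor
    · intro hi
      have h1 := test 1 fun h => absurd h (not_le.mpr hi)
      have h2 := test (-1) fun h => absurd h (not_le.mpr hi)
      linarith
    · intro hi
      have h0 := hz i hi
      have h1 := test 1 fun _ => by linarith
      -- Moving coordinate `i` to the boundary value `0` gives `0 ≤ z i * ν i`; the reverse
      -- inequality follows from `0 ≤ z i` and `ν i ≤ 0`.
      have h2 := test (-z i) fun _ => by linarith
      exact ⟨h0, by linarith, by nlinarith⟩
  · refine fun h => ⟨fun i hi => ((h i).2 hi).1, fun y hy => ?_⟩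
    rw [PiLp.inner_apply]
    refine Finset.sum_nonpos fun i _ => ?_
    have e : inner ℝ (ν i) ((y - z) i) = (y i - z i) * ν i := rfl
    rw [e]
    rcases lt_or_ge (i : ℕ) s with hi | hi
    · rw [(h i).1 hi, mul_zero]
    · obtain ⟨h1, h2, h3⟩ := (h i).2 hi
      have := mul_nonpos_of_nonneg_of_nonpos (hy i hi) h2
      linarith

namespace NashKKT

variable {N : ℕ} {n m d : Fin N → ℕ}

theorem stack_add (x y : Profile n) : stack (x + y) = stack x + stack y := rfl

theorem stack_smul (t : ℝ) (x : Profile n) : stack (t • x) = t • stack x := rfl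

theorem stack_dotProduct (x : Profile n) (v : (Σ j, Fin (n j)) → ℝ) :
    stack x ⬝ᵥ v = ∑ k, (x k).ofLp ⬝ᵥ fun e => v ⟨k, e⟩ :=
  Fintype.sum_sigma _

theorem stack_single_dotProduct (k : Fin N) (h : E (n k)) (v : (Σ j, Fin (n j)) → ℝ) :
    stack (Pi.single k h) ⬝ᵥ v = h.ofLp ⬝ᵥ fun e => v ⟨k, e⟩ := by
  rw [stack_dotProduct, Finset.sum_eq_single k]
  · rw [Pi.single_eq_same]
  · intro j _ hj
    rw [Pi.single_eq_of_ne hj]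
    exact zero_dotProduct _
  · simp

namespace QPData

variable (Q : QPData n m d)

theorem mulVec_stack (k : Fin N) (w : E (d k)) (x : Profile n) (j : Fin N) :
    (fun e => (Q.P k w *ᵥ stack x) ⟨j, e⟩) = ∑ i, Q.block k w j i *ᵥ (x i).ofLp := by
  ext e
  rw [Finset.sum_apply, Matrix.mulVec, dotProduct_comm, stack_dotProduct]
  exact Finset.sum_congr rfl fun i _ => dotProduct_comm _ _

/-- The partial gradient of the objective of player `k` with respect to `x^k`. -/
def gradObjective (k : Fin N) (x : Profile n) (w : E (d k)) : Fin (n k) → ℝ :=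
  -- Symmetrized, because `P^k` is assumed symmetric at the reference parameter only.
  fun e => 1 / 2 * ((Q.P k w + (Q.P k w)ᵀ) *ᵥ stack x) ⟨k, e⟩ - Q.c k w ⟨k, e⟩

/-- The Taylor expansion is exact. It yields the partial gradient and, later, the comparison of
objective values for local minimality. -/
theorem f_update_add (k : Fin N) (x : Profile n) (w : E (d k)) (h : E (n k)) :
    Q.toNEP.f k (Function.update x k (x k + h)) w =
      Q.toNEP.f k x w + Q.gradObjective k x w ⬝ᵥ h.ofLp +
        1 / 2 * (h.ofLp ⬝ᵥ Q.block k w k k *ᵥ h.ofLp) := by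
  have hu : Function.update x k (x k + h) = x + Pi.single k h := by
    ext j : 1
    rcases eq_or_ne j k with rfl | hj
    · simp
    · simp [hj]
  have hquad : stack (Pi.single k h) ⬝ᵥ Q.P k w *ᵥ stack (Pi.single k h)
      = h.ofLp ⬝ᵥ Q.block k w k k *ᵥ h.ofLp := by
    rw [stack_single_dotProduct, mulVec_stack, Finset.sum_eq_single k]
    · rw [Pi.single_eq_same]
    · intro j _ hj
      rw [Pi.single_eq_of_ne hj]
      exact Matrix.mulVec_zero _
    · simp
  have hlin : Q.gradObjective k x w ⬝ᵥ h.ofLp =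
      1 / 2 * (stack (Pi.single k h) ⬝ᵥ Q.P k w *ᵥ stack x +
        stack x ⬝ᵥ Q.P k w *ᵥ stack (Pi.single k h)) -
      (Q.c k w).ofLp ⬝ᵥ stack (Pi.single k h) := by
    rw [Matrix.dotProduct_mulVec (stack x), ← Matrix.mulVec_transpose,
      dotProduct_comm ((Q.P k w)ᵀ *ᵥ stack x), ← dotProduct_add, ← Matrix.add_mulVec,
      dotProduct_comm (Q.c k w).ofLp, stack_single_dotProduct, stack_single_dotProduct,
      dotProduct_comm]
    simp only [gradObjective, dotProduct, Finset.mul_sum, ← Finset.sum_sub_distrib]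
    exact Finset.sum_congr rfl fun e _ => by ring
  rw [hu, hlin, ← hquad]
  simp only [toNEP, stack_add, Matrix.mulVec_add, dotProduct_add, add_dotProduct]
  ring

theorem lagrangian_update_add (k : Fin N) (x : Profile n) (l : E (m k)) (w : E (d k))
    (h : E (n k)) :
    Q.toNEP.lagrangian k (Function.update x k (x k + h)) l w =
      Q.toNEP.lagrangian k x l w + (Q.gradObjective k x w + (Q.A k w)ᵀ *ᵥ l.ofLp) ⬝ᵥ h.ofLp +
        1 / 2 * (h.ofLp ⬝ᵥ Q.block k w k k *ᵥ h.ofLp) := by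
  have e : ((Q.A k w)ᵀ *ᵥ l.ofLp) ⬝ᵥ h.ofLp = ∑ i, l i * ((Q.a k i w).ofLp ⬝ᵥ h.ofLp) := by
    rw [Matrix.mulVec_transpose, ← Matrix.dotProduct_mulVec]
    rfl
  rw [NEP.lagrangian, f_update_add, NEP.lagrangian, add_dotProduct, e]
  simp only [toNEP, Function.update_self]
  have e2 : ∑ i, l i * ((Q.a k i w).ofLp ⬝ᵥ (x k + h).ofLp - Q.b k i) =
      ∑ i, l i * ((Q.a k i w).ofLp ⬝ᵥ (x k).ofLp - Q.b k i) +
        ∑ i, l i * ((Q.a k i w).ofLp ⬝ᵥ h.ofLp) := by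
    rw [← Finset.sum_add_distrib]
    refine Finset.sum_congr rfl fun i _ => ?_
    rw [WithLp.ofLp_add, dotProduct_add]
    ring
  rw [e2]
  ring

theorem gradLagrangian_eq (k : Fin N) (x : Profile n) (l : E (m k)) (w : E (d k)) :
    Q.toNEP.gradLagrangian k x l w =
      WithLp.toLp 2 (Q.gradObjective k x w + (Q.A k w)ᵀ *ᵥ l.ofLp) := by
  refine HasGradientAt.gradient ?_
  rw [hasGradientAt_iff_isLittleO_nhds_zero]
  have e : ∀ h : E (n k), Q.toNEP.lagrangian k (Function.update x k (x k + h)) l w -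
      Q.toNEP.lagrangian k (Function.update x k (x k)) l w -
      inner ℝ (WithLp.toLp 2 (Q.gradObjective k x w + (Q.A k w)ᵀ *ᵥ l.ofLp)) h =
      1 / 2 * inner ℝ h (Matrix.toEuclideanCLM (𝕜 := ℝ) (Q.block k w k k) h) := by
    intro h
    rw [lagrangian_update_add, Function.update_eq_self, EuclideanSpace.inner_eq_star_dotProduct,
      EuclideanSpace.inner_eq_star_dotProduct, star_trivial, star_trivial, dotProduct_comm h.ofLp,
      dotProduct_comm h.ofLp, Matrix.ofLp_toEuclideanCLM]
    ring
  simp only [e]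
  refine Asymptotics.IsBigO.trans_isLittleO
    (g := fun h : E (n k) => ‖h‖ ^ 2) ?_ ?_
  · refine Asymptotics.IsBigO.of_bound (1 / 2 * ‖Matrix.toEuclideanCLM (𝕜 := ℝ) (Q.block k w k k)‖)
      (Eventually.of_forall fun h => ?_)
    rw [norm_mul, Real.norm_of_nonneg (by norm_num : (0 : ℝ) ≤ 1 / 2), norm_pow, norm_norm,
      mul_assoc]
    refine mul_le_mul_of_nonneg_left ((norm_inner_le_norm _ _).trans ?_) (by norm_num)
    have := mul_le_mul_of_nonneg_left
      ((Matrix.toEuclideanCLM (𝕜 := ℝ) (Q.block k w k k)).le_opNorm h) (norm_nonneg h)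
    linarith
  · exact Asymptotics.isLittleO_norm_pow_id one_lt_two

theorem mem_SKKT_iff {p : Param n m d} {x : Profile n} {l : Profile m} :
    (x, l) ∈ Q.toNEP.SKKT p ↔ ∀ k,
      (p k).2.1.ofLp = Q.gradObjective k x (p k).2.2 + (Q.A k (p k).2.2)ᵀ *ᵥ (l k).ofLp ∧
      ∀ i : Fin (m k), ((i : ℕ) < Q.s k → Q.toNEP.g k i (x k) (p k).2.2 - (p k).1 i = 0) ∧
        (Q.s k ≤ (i : ℕ) → 0 ≤ l k i ∧ Q.toNEP.g k i (x k) (p k).2.2 - (p k).1 i ≤ 0 ∧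
          l k i * (Q.toNEP.g k i (x k) (p k).2.2 - (p k).1 i) = 0) := by
  refine forall_congr' fun k => and_congr ?_ ?_
  · rw [gradLagrangian_eq]
    exact ⟨fun h => congrArg WithLp.ofLp h, fun h => WithLp.ofLp_injective 2 h⟩
  · have : ∀ ν : E (m k), -(p k).1 = -Q.toNEP.constraintVec k (x k) (p k).2.2 + ν ↔
        ν = Q.toNEP.constraintVec k (x k) (p k).2.2 - (p k).1 := by
      intro ν
      constructor
      · intro h; rw [sub_eq_add_neg, h]; abel
      · rintro rfl; abel
    simp only [this, exists_eq_right]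
    exact mem_normalCone_multiplierCone_iff

end QPData

end NashKKT

end KKT

/-! ### Positive definiteness of the game Jacobian. -/

section Definiteness

open scoped Matrix

/-- Completing the square in a block quadratic form bounds it below by a Schur complement. -/
theorem schur_complement_le {ι κ ρ : Type*} [Fintype ι] [Fintype κ] [Fintype ρ] [DecidableEq ρ]
    {P : Matrix ι ι ℝ} (hP : P.IsSymm) (R : Matrix κ κ ℝ) (T : Matrix ι κ ℝ) {B : Matrix ι ρ ℝ}
    (hD : ∀ η, η ≠ 0 → 0 < η ⬝ᵥ (Bᵀ * P * B) *ᵥ η) {a b : ℝ} (ha : 0 < a) (hb : 0 < b)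
    (η : ρ → ℝ) (y : κ → ℝ) :
    b * (y ⬝ᵥ (R - (1 / (4 * a * b)) • (Tᵀ * B * (Bᵀ * P * B)⁻¹ * Bᵀ * T)) *ᵥ y) ≤
      a * ((B *ᵥ η) ⬝ᵥ P *ᵥ (B *ᵥ η)) + b * (y ⬝ᵥ R *ᵥ y) + (B *ᵥ η) ⬝ᵥ T *ᵥ y := by
  set D := Bᵀ * P * B with hDdef
  have hDsymm : Dᵀ = D := by
    rw [hDdef, Matrix.transpose_mul, Matrix.transpose_mul, Matrix.transpose_transpose, hP.eq,
      Matrix.mul_assoc]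
  have hunit : IsUnit D := by
    rw [← Matrix.mulVec_injective_iff_isUnit]
    refine (injective_iff_map_eq_zero (Matrix.mulVecLin D)).mpr fun η h => ?_
    by_contra hne
    have := hD η hne
    rw [Matrix.mulVecLin_apply] at h
    rw [h, dotProduct_zero] at this
    exact lt_irrefl _ this
  set β := Bᵀ *ᵥ T *ᵥ y with hβ
  -- The right-hand side is minimized over `η` at `-ζ / (2a)`; this is the shift in the square
  -- `hsq`, and the minimum produces the term `-ζ ⬝ᵥ D *ᵥ ζ / (4a)`.
  set ζ := D⁻¹ *ᵥ β with hζ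
  have hDζ : D *ᵥ ζ = β := by
    rw [hζ, Matrix.mulVec_mulVec, Matrix.mul_nonsing_inv _ ((Matrix.isUnit_iff_isUnit_det _).mp hunit),
      Matrix.one_mulVec]
  have e1 : (B *ᵥ η) ⬝ᵥ P *ᵥ (B *ᵥ η) = η ⬝ᵥ D *ᵥ η := by
    rw [hDdef, ← Matrix.mulVec_mulVec, ← Matrix.mulVec_mulVec, Matrix.dotProduct_mulVec η,
      Matrix.vecMul_transpose]
  have e2 : (B *ᵥ η) ⬝ᵥ T *ᵥ y = η ⬝ᵥ D *ᵥ ζ := by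
    rw [hDζ, hβ, Matrix.dotProduct_mulVec η, Matrix.vecMul_transpose]
  have e3 : y ⬝ᵥ (Tᵀ * B * D⁻¹ * Bᵀ * T) *ᵥ y = ζ ⬝ᵥ D *ᵥ ζ := by
    simp only [← Matrix.mulVec_mulVec]
    rw [← hβ, ← hζ, hDζ, Matrix.dotProduct_mulVec y, Matrix.vecMul_transpose,
      Matrix.dotProduct_mulVec (T *ᵥ y), ← Matrix.mulVec_transpose, dotProduct_comm]
  have hsw : ζ ⬝ᵥ D *ᵥ η = η ⬝ᵥ D *ᵥ ζ := by
    rw [Matrix.dotProduct_mulVec ζ, ← Matrix.mulVec_transpose, hDsymm, dotProduct_comm]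
  have hsq : 0 ≤ (η + (1 / (2 * a)) • ζ) ⬝ᵥ D *ᵥ (η + (1 / (2 * a)) • ζ) := by
    by_cases h0 : η + (1 / (2 * a)) • ζ = 0
    · rw [h0, zero_dotProduct]
    · exact (hD _ h0).le
  simp only [Matrix.mulVec_add, Matrix.mulVec_smul, add_dotProduct, dotProduct_add,
    smul_dotProduct, dotProduct_smul, smul_eq_mul, hsw] at hsq
  rw [Matrix.sub_mulVec, dotProduct_sub, Matrix.smul_mulVec, dotProduct_smul, smul_eq_mul, e1, e2,
    e3]
  have h := mul_nonneg ha.le hsq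
  have i1 : b * (1 / (4 * a * b) * (ζ ⬝ᵥ D *ᵥ ζ)) = 1 / (4 * a) * (ζ ⬝ᵥ D *ᵥ ζ) := by
    field_simp
  have i2 : a * (η ⬝ᵥ D *ᵥ η + 1 / (2 * a) * (η ⬝ᵥ D *ᵥ ζ) + 1 / (2 * a) * (η ⬝ᵥ D *ᵥ ζ +
      1 / (2 * a) * (ζ ⬝ᵥ D *ᵥ ζ))) =
      a * (η ⬝ᵥ D *ᵥ η) + η ⬝ᵥ D *ᵥ ζ + 1 / (4 * a) * (ζ ⬝ᵥ D *ᵥ ζ) := by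
    field_simp; ring
  rw [mul_sub, i1]
  linarith [h.trans_eq i2]

/-- Weighted Schur complement conditions on all pairs of blocks make a block matrix positive
definite on a product of subspaces. -/
theorem sum_dotProduct_mulVec_pos {N : ℕ} {n r : Fin N → ℕ}
    {H : ∀ i j, Matrix (Fin (n i)) (Fin (n j)) ℝ} (hsymm : ∀ k, (H k k).IsSymm)
    {M : ∀ k, Submodule ℝ (Fin (n k) → ℝ)} {B : ∀ k, Matrix (Fin (n k)) (Fin (r k)) ℝ}
    (hBind : ∀ k, LinearIndependent ℝ (B k).col)
    (hBspan : ∀ k, Submodule.span ℝ (Set.range (B k).col) = M k)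
    (hpos : ∀ k, ∀ y ∈ M k, y ≠ 0 → 0 < y ⬝ᵥ H k k *ᵥ y)
    {α : Fin N → Fin N → ℝ} (hα : ∀ i j, j ≠ i → 0 < α i j)
    (hsum : 2 ≤ N → ∀ i, ∑ j ∈ Finset.univ.filter (fun j => j ≠ i), α i j = 1)
    (hschur : ∀ i k, i ≠ k → ∀ y ∈ M k, y ≠ 0 →
      0 < y ⬝ᵥ (H k k - (1 / (4 * α i k * α k i)) •
        ((H i k + (H k i)ᵀ)ᵀ * B i * ((B i)ᵀ * H i i * B i)⁻¹ * (B i)ᵀ * (H i k + (H k i)ᵀ))) *ᵥ y)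
    {y : ∀ k, Fin (n k) → ℝ} (hy : ∀ k, y k ∈ M k) (hne : y ≠ 0) :
    0 < ∑ k, y k ⬝ᵥ ∑ i, H k i *ᵥ y i := by
  have hcol : ∀ i (η : Fin (r i) → ℝ), B i *ᵥ η ∈ M i := by
    intro i η
    rw [← hBspan, ← Matrix.range_mulVecLin]
    exact LinearMap.mem_range.mpr ⟨η, rfl⟩
  have hD : ∀ i (η : Fin (r i) → ℝ), η ≠ 0 → 0 < η ⬝ᵥ ((B i)ᵀ * H i i * B i) *ᵥ η := by
    intro i η hη
    have h0 : B i *ᵥ η ≠ 0 := fun h => hη (Matrix.mulVec_injective_iff.mpr (hBind i) (by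
      rw [h, Matrix.mulVec_zero]))
    have := hpos i _ (hcol i η) h0
    rwa [← Matrix.mulVec_mulVec, ← Matrix.mulVec_mulVec, Matrix.dotProduct_mulVec η,
      Matrix.vecMul_transpose]
  -- The share of the full form belonging to players `i` and `k`. As the weights of each player sum
  -- to `1`, summation over ordered pairs counts the full form twice (`hdouble`).
  set q : Fin N → Fin N → ℝ := fun i k => α i k * (y i ⬝ᵥ H i i *ᵥ y i) +
    α k i * (y k ⬝ᵥ H k k *ᵥ y k) + y i ⬝ᵥ (H i k + (H k i)ᵀ) *ᵥ y k with hq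
  have hle : ∀ i k, i ≠ k → α k i * (y k ⬝ᵥ (H k k - (1 / (4 * α i k * α k i)) •
        ((H i k + (H k i)ᵀ)ᵀ * B i * ((B i)ᵀ * H i i * B i)⁻¹ * (B i)ᵀ *
          (H i k + (H k i)ᵀ))) *ᵥ y k) ≤ q i k := by
    intro i k hik
    have hmem := hy i
    rw [← hBspan, ← Matrix.range_mulVecLin] at hmem
    obtain ⟨η, hη⟩ := LinearMap.mem_range.mp hmem
    rw [Matrix.mulVecLin_apply] at hη
    have := schur_complement_le (hsymm i) (H k k) (H i k + (H k i)ᵀ) (hD i) (hα i k hik.symm)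
      (hα k i hik) η (y k)
    rwa [hη] at this
  have hqpos : ∀ i k, i ≠ k → y k ≠ 0 → 0 < q i k := fun i k hik h0 =>
    (mul_pos (hα k i hik) (hschur i k hik _ (hy k) h0)).trans_le (hle i k hik)
  have hqnn : ∀ i k, i ≠ k → 0 ≤ q i k := by
    intro i k hik
    by_cases h0 : y k = 0
    · have := hle i k hik
      rwa [h0, zero_dotProduct, mul_zero] at this
    · exact (hqpos i k hik h0).le
  obtain ⟨k₀, hk₀⟩ := Function.ne_iff.mp hne
  rcases lt_or_ge N 2 with hN | hN
  -- A single player forms no pair, so the diagonal block is used directly.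
  · have hsub : ∀ i, i = k₀ := fun i => Fin.ext (by omega)
    rw [Finset.sum_eq_single k₀ (fun i _ h => absurd (hsub i) h) (by simp),
      Finset.sum_eq_single k₀ (fun i _ h => absurd (hsub i) h) (by simp)]
    exact hpos k₀ _ (hy k₀) hk₀
  have hdouble : 2 * ∑ k, y k ⬝ᵥ ∑ i, H k i *ᵥ y i =
      ∑ k, ∑ i ∈ Finset.univ.filter (fun i => i ≠ k), q i k := by
    have hswap : ∀ F : Fin N → Fin N → ℝ,
        ∑ k, ∑ i ∈ Finset.univ.filter (fun i => i ≠ k), F i k =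
          ∑ k, ∑ i ∈ Finset.univ.filter (fun i => i ≠ k), F k i := by
      intro F
      simp only [Finset.sum_filter]
      rw [Finset.sum_comm]
      exact Finset.sum_congr rfl fun i _ => Finset.sum_congr rfl fun k _ => by
        simp only [ne_comm]
    have hw : ∑ k, ∑ i ∈ Finset.univ.filter (fun i => i ≠ k), α k i * (y k ⬝ᵥ H k k *ᵥ y k) =
        ∑ k, y k ⬝ᵥ H k k *ᵥ y k := by
      refine Finset.sum_congr rfl fun k _ => ?_
      rw [← Finset.sum_mul, hsum hN k, one_mul]
    have htr : ∀ i k, y i ⬝ᵥ (H i k + (H k i)ᵀ) *ᵥ y k =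
        y i ⬝ᵥ H i k *ᵥ y k + y k ⬝ᵥ H k i *ᵥ y i := by
      intro i k
      rw [Matrix.add_mulVec, dotProduct_add, Matrix.dotProduct_mulVec (y i) (H k i)ᵀ,
        Matrix.vecMul_transpose, dotProduct_comm (H k i *ᵥ y i)]
    have hdiag : ∑ k, y k ⬝ᵥ ∑ i, H k i *ᵥ y i = ∑ k, y k ⬝ᵥ H k k *ᵥ y k +
        ∑ k, ∑ i ∈ Finset.univ.filter (fun i => i ≠ k), y k ⬝ᵥ H k i *ᵥ y i := by
      rw [← Finset.sum_add_distrib]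
      refine Finset.sum_congr rfl fun k _ => ?_
      rw [dotProduct_sum, Finset.filter_ne']
      exact (Finset.add_sum_erase _ (fun i => y k ⬝ᵥ H k i *ᵥ y i) (Finset.mem_univ k)).symm
    simp only [hq, htr, Finset.sum_add_distrib]
    rw [hswap (fun i k => α i k * (y i ⬝ᵥ H i i *ᵥ y i)), hw,
      hswap (fun i k => y i ⬝ᵥ H i k *ᵥ y k), hdiag]
    ring
  have : 0 < ∑ k, ∑ i ∈ Finset.univ.filter (fun i => i ≠ k), q i k := by
    have hnn : ∀ k, ∀ i ∈ Finset.univ.filter (fun i => i ≠ k), 0 ≤ q i k :=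
      fun k i hi => hqnn i k (Finset.mem_filter.mp hi).2
    have : Nontrivial (Fin N) := Fin.nontrivial_iff_two_le.mpr hN
    obtain ⟨i₀, hi₀⟩ := exists_ne k₀
    refine Finset.sum_pos' (fun k _ => Finset.sum_nonneg (hnn k)) ⟨k₀, Finset.mem_univ _, ?_⟩
    exact Finset.sum_pos' (hnn k₀) ⟨i₀, by simpa using hi₀, hqpos i₀ k₀ hi₀ hk₀⟩
  linarith

end Definiteness

/-! ### Reduction of the KKT system to a mixed LCP, and strong regularity. -/

noncomputable section Regularity

open scoped Matrix Classical

theorem sum_subtype_of_eq_zero {ι : Type*} [Fintype ι] {p : ι → Prop} {F : Type*}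
    [AddCommMonoid F] (f : ι → F) (h : ∀ i, ¬p i → f i = 0) : ∑ i : {i // p i}, f i = ∑ i, f i := by
  rw [← Finset.sum_subtype (Finset.univ.filter p) (by simp) f]
  refine Finset.sum_filter_of_ne fun i _ hi => ?_
  by_contra hp
  exact hi (h i hp)

namespace NashKKT.QPData

variable {N : ℕ} {n m d : Fin N → ℕ} (Q : QPData n m d)

/-- The linear part of the KKT system in which the constraints in `I` are active and the
multipliers of the other constraints are prescribed. -/
def kktOperator (I : ∀ k, Set (Fin (m k))) (p : Param n m d) :
    Profile n × Profile m →L[ℝ] Profile n × Profile m :=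
  LinearMap.toContinuousLinearMap
    { toFun := fun z =>
        (fun k => WithLp.toLp 2 fun e =>
          1 / 2 * ((Q.P k (p k).2.2 + (Q.P k (p k).2.2)ᵀ) *ᵥ stack z.1) ⟨k, e⟩ +
            ((Q.A k (p k).2.2)ᵀ *ᵥ (z.2 k).ofLp) e,
          fun k => WithLp.toLp 2 fun i =>
            -- Rows outside `I` return the multiplier itself, which keeps the system square: the
            -- right-hand side supplies `μ` on `J` and `0` on inactive constraints.
            if i ∈ I k then Q.A k (p k).2.2 i ⬝ᵥ (z.1 k).ofLp else z.2 k i)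
      map_add' := by
        intro z z'
        ext k i
        · simp only [Prod.fst_add, Prod.snd_add, stack_add, Matrix.mulVec_add, Pi.add_apply,
            WithLp.ofLp_add]
          ring
        · simp only [Prod.fst_add, Prod.snd_add, Pi.add_apply, WithLp.ofLp_add, dotProduct_add]
          split_ifs <;> rfl
      map_smul' := by
        intro t z
        ext k i
        · simp only [Prod.smul_fst, Prod.smul_snd, stack_smul, Matrix.mulVec_smul, Pi.smul_apply,
            WithLp.ofLp_smul, smul_eq_mul, RingHom.id_apply]
          ring
        · simp only [Prod.smul_fst, Prod.smul_snd, Pi.smul_apply, WithLp.ofLp_smul,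
            dotProduct_smul, smul_eq_mul, RingHom.id_apply]
          split_ifs <;> rfl }

/-- The right-hand side of the KKT system in which the constraints in `I` are active. -/
def kktRhs (I : ∀ k, Set (Fin (m k))) (p : Param n m d) : Profile n × Profile m :=
  (fun k => WithLp.toLp 2 fun e => Q.c k (p k).2.2 ⟨k, e⟩ + (p k).2.1 e,
    fun k => WithLp.toLp 2 fun i => if i ∈ I k then Q.b k i + (p k).1 i else 0)

/-- The index type of a family of sets of constraints. -/
abbrev ConstraintIndex (J : ∀ k, Set (Fin (m k))) : Type :=
  {j : Σ k, Fin (m k) // j.2 ∈ J j.1}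

/-- The inclusion of the multipliers of the constraints in `J` into the unknowns. -/
def multiplierInclusion (n : Fin N → ℕ) (J : ∀ k, Set (Fin (m k))) :
    EuclideanSpace ℝ (ConstraintIndex J) →L[ℝ] Profile n × Profile m :=
  LinearMap.toContinuousLinearMap
    { toFun := fun μ =>
        (0, fun k => WithLp.toLp 2 fun i => if h : i ∈ J k then μ ⟨⟨k, i⟩, h⟩ else 0)
      map_add' := by
        intro μ μ'
        ext k i
        · simp
        · simp only [Prod.snd_add, Pi.add_apply, PiLp.add_apply]
          split_ifs <;> simp
      map_smul' := by
        intro t μ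
        ext k i
        · simp
        · simp only [Prod.smul_snd, Pi.smul_apply, PiLp.smul_apply, RingHom.id_apply]
          split_ifs <;> simp }

/-- The linear parts of the constraints in `J`. -/
def constraintOperator (J : ∀ k, Set (Fin (m k))) (p : Param n m d) :
    Profile n × Profile m →L[ℝ] EuclideanSpace ℝ (ConstraintIndex J) :=
  LinearMap.toContinuousLinearMap
    { toFun := fun z =>
        WithLp.toLp 2 fun j => Q.A j.1.1 (p j.1.1).2.2 j.1.2 ⬝ᵥ (z.1 j.1.1).ofLp
      map_add' := by
        intro z z'
        ext j
        simp
      map_smul' := by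
        intro t z
        ext j
        simp }

/-- The right-hand sides of the constraints in `J`. -/
def constraintRhs (J : ∀ k, Set (Fin (m k))) (p : Param n m d) :
    EuclideanSpace ℝ (ConstraintIndex J) :=
  WithLp.toLp 2 fun j => Q.b j.1.1 j.1.2 + (p j.1.1).1 j.1.2

variable {Q} {p₀ : Param n m d}

theorem contDiffAt_param (k : Fin N) : ContDiffAt ℝ 1 (fun p : Param n m d => p k) p₀ :=
  contDiffAt_pi.mp contDiffAt_id k

theorem SmoothAt.contDiffAt_P (h : Q.SmoothAt fun k => (p₀ k).2.2) (k : Fin N)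
    (i j : Σ j, Fin (n j)) : ContDiffAt ℝ 1 (fun p : Param n m d => Q.P k (p k).2.2 i j) p₀ :=
  ContDiffAt.comp (f := fun p : Param n m d => (p k).2.2) p₀ ((h k).1 i j)
    (contDiffAt_param k).snd.snd

theorem SmoothAt.contDiffAt_A (h : Q.SmoothAt fun k => (p₀ k).2.2) (k : Fin N)
    (i : Fin (m k)) (j : Fin (n k)) :
    ContDiffAt ℝ 1 (fun p : Param n m d => Q.A k (p k).2.2 i j) p₀ :=
  ContDiffAt.comp (f := fun p : Param n m d => (p k).2.2) (g := fun w => Q.a k i w j) p₀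
    (contDiffAt_euclidean.mp ((h k).2.2 i) j) (contDiffAt_param k).snd.snd

theorem SmoothAt.contDiffAt_c (h : Q.SmoothAt fun k => (p₀ k).2.2) (k : Fin N)
    (i : Σ j, Fin (n j)) : ContDiffAt ℝ 1 (fun p : Param n m d => Q.c k (p k).2.2 i) p₀ :=
  ContDiffAt.comp (f := fun p : Param n m d => (p k).2.2) (g := fun w => Q.c k w i) p₀
    (contDiffAt_euclidean.mp (h k).2.1 i) (contDiffAt_param k).snd.snd

theorem contDiffAt_kktOperator (h : Q.SmoothAt fun k => (p₀ k).2.2)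
    (I : ∀ k, Set (Fin (m k))) : ContDiffAt ℝ 1 (Q.kktOperator I) p₀ := by
  refine contDiffAt_clm_of_apply fun z => ContDiffAt.prodMk (contDiffAt_pi.mpr fun k =>
    contDiffAt_euclidean.mpr fun e => ?_) (contDiffAt_pi.mpr fun k =>
    contDiffAt_euclidean.mpr fun i => ?_)
  · have hA : ContDiffAt ℝ 1 (fun p : Param n m d => ∑ i, Q.A k (p k).2.2 i e * z.2 k i) p₀ :=
      ContDiffAt.sum fun i _ => (h.contDiffAt_A k i e).mul contDiffAt_const
    refine (contDiffAt_const.mul (ContDiffAt.sum fun j _ => ?_)).add hA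
    exact ((h.contDiffAt_P k _ _).add (h.contDiffAt_P k _ _)).mul contDiffAt_const
  · by_cases hi : i ∈ I k
    · simp only [hi, if_true]
      exact ContDiffAt.sum fun e _ => (h.contDiffAt_A k i e).mul contDiffAt_const
    · simp only [hi, if_false]
      exact contDiffAt_const

theorem contDiffAt_kktRhs (h : Q.SmoothAt fun k => (p₀ k).2.2)
    (I : ∀ k, Set (Fin (m k))) : ContDiffAt ℝ 1 (Q.kktRhs I) p₀ := by
  refine ContDiffAt.prodMk (contDiffAt_pi.mpr fun k => contDiffAt_euclidean.mpr fun e => ?_)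
    (contDiffAt_pi.mpr fun k => contDiffAt_euclidean.mpr fun i => ?_)
  · exact (h.contDiffAt_c k _).add (contDiffAt_euclidean.mp (contDiffAt_param k).snd.fst e)
  · by_cases hi : i ∈ I k
    · simp only [hi, if_true]
      exact contDiffAt_const.add (contDiffAt_euclidean.mp (contDiffAt_param k).fst i)
    · simp only [hi, if_false]
      exact contDiffAt_const

theorem contDiffAt_constraintOperator (h : Q.SmoothAt fun k => (p₀ k).2.2)
    (J : ∀ k, Set (Fin (m k))) : ContDiffAt ℝ 1 (Q.constraintOperator J) p₀ :=
  contDiffAt_clm_of_apply fun z => contDiffAt_euclidean.mpr fun j => by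
    have hA : ContDiffAt ℝ 1 (fun p : Param n m d =>
        ∑ e, Q.A j.1.1 (p j.1.1).2.2 j.1.2 e * z.1 j.1.1 e) p₀ :=
      ContDiffAt.sum fun e _ => (h.contDiffAt_A _ _ e).mul contDiffAt_const
    exact hA

theorem contDiffAt_constraintRhs (J : ∀ k, Set (Fin (m k))) :
    ContDiffAt ℝ 1 (Q.constraintRhs J) p₀ :=
  contDiffAt_euclidean.mpr fun j =>
    contDiffAt_const.add (contDiffAt_euclidean.mp (contDiffAt_param j.1.1).fst j.1.2)

/-- Positivity of the linearized KKT system. -/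
theorem inner_constraintOperator_neg {I J : ∀ k, Set (Fin (m k))} (hIJ : ∀ k, Disjoint (I k) (J k))
    (hsymm : ∀ k, (Q.P k (p₀ k).2.2).IsSymm)
    (hli : ∀ k, LinearIndependent ℝ (fun i : ↥(I k ∪ J k) => (Q.A k (p₀ k).2.2).row i))
    (hpos : ∀ y : ∀ k, Fin (n k) → ℝ, (∀ k, ∀ i ∈ I k, Q.A k (p₀ k).2.2 i ⬝ᵥ y k = 0) → y ≠ 0 →
      0 < ∑ k, y k ⬝ᵥ ∑ i, Q.block k (p₀ k).2.2 k i *ᵥ y i)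
    {z : Profile n × Profile m} {μ : EuclideanSpace ℝ (ConstraintIndex J)}
    (h : Q.kktOperator I p₀ z = multiplierInclusion n J μ) (hz : z ≠ 0) :
    inner ℝ (Q.constraintOperator J p₀ z) μ < 0 := by
  obtain ⟨x, l⟩ := z
  have hstat : ∀ k, (∑ i, Q.block k (p₀ k).2.2 k i *ᵥ (x i).ofLp) +
      (Q.A k (p₀ k).2.2)ᵀ *ᵥ (l k).ofLp = 0 := by
    intro k
    rw [← mulVec_stack]
    ext e
    have : 1 / 2 * ((Q.P k (p₀ k).2.2 + (Q.P k (p₀ k).2.2)ᵀ) *ᵥ stack x) ⟨k, e⟩ +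
        ((Q.A k (p₀ k).2.2)ᵀ *ᵥ (l k).ofLp) e = 0 :=
      congrArg (fun z : Profile n × Profile m => z.1 k e) h
    rw [(hsymm k).eq, Matrix.add_mulVec, Pi.add_apply] at this
    rw [Pi.add_apply, Pi.zero_apply, ← this]
    ring
  have hrow : ∀ k i, (if i ∈ I k then Q.A k (p₀ k).2.2 i ⬝ᵥ (x k).ofLp else l k i) =
      if h : i ∈ J k then μ ⟨⟨k, i⟩, h⟩ else 0 :=
    fun k i => congrArg (fun z : Profile n × Profile m => z.2 k i) h
  have hI : ∀ k, ∀ i ∈ I k, Q.A k (p₀ k).2.2 i ⬝ᵥ (x k).ofLp = 0 := by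
    intro k i hi
    have := hrow k i
    rwa [if_pos hi, dif_neg (Set.disjoint_left.mp (hIJ k) hi)] at this
  have hJ : ∀ k i (hi : i ∈ J k), l k i = μ ⟨⟨k, i⟩, hi⟩ := by
    intro k i hi
    have := hrow k i
    rwa [if_neg (Set.disjoint_right.mp (hIJ k) hi), dif_pos hi] at this
  have hl : ∀ k i, i ∉ I k → i ∉ J k → l k i = 0 := by
    intro k i hi hi'
    have := hrow k i
    rwa [if_neg hi, dif_neg hi'] at this
  -- The sum extends from `J` to all constraints at no cost: on `I` the row products with `x`
  -- vanish, and outside `I ∪ J` the multipliers do.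
  have hinner : inner ℝ (Q.constraintOperator J p₀ (x, l)) μ =
      ∑ k, (x k).ofLp ⬝ᵥ (Q.A k (p₀ k).2.2)ᵀ *ᵥ (l k).ofLp := by
    have e1 : inner ℝ (Q.constraintOperator J p₀ (x, l)) μ = ∑ j : ConstraintIndex J,
        l j.1.1 j.1.2 * (Q.A j.1.1 (p₀ j.1.1).2.2 j.1.2 ⬝ᵥ (x j.1.1).ofLp) := by
      rw [PiLp.inner_apply]
      refine Finset.sum_congr rfl fun j _ => ?_
      rw [hJ _ _ j.2]
      rfl
    rw [e1, sum_subtype_of_eq_zero (fun j : Σ k, Fin (m k) =>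
      l j.1 j.2 * (Q.A j.1 (p₀ j.1).2.2 j.2 ⬝ᵥ (x j.1).ofLp)), Fintype.sum_sigma]
    · refine Finset.sum_congr rfl fun k _ => ?_
      rw [Matrix.dotProduct_mulVec, Matrix.vecMul_transpose, dotProduct_comm]
      rfl
    · intro j hj
      by_cases hj' : j.2 ∈ I j.1
      · rw [hI _ _ hj', mul_zero]
      · rw [hl _ _ hj' hj, zero_mul]
  -- If `x = 0`, stationarity reads `(A^k)ᵀ λ^k = 0`, and independence of the active rows forces `λ
  -- = 0`.
  have hx : x ≠ 0 := by
    rintro rfl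
    refine hz (Prod.ext rfl ?_)
    ext k i
    have h0 : (Q.A k (p₀ k).2.2)ᵀ *ᵥ (l k).ofLp = 0 := by
      rw [← hstat k, Finset.sum_eq_zero, zero_add]
      exact fun i _ => Matrix.mulVec_zero _
    have hsum : ∑ i : ↥(I k ∪ J k), l k i • (Q.A k (p₀ k).2.2).row i = 0 := by
      convert (sum_subtype_of_eq_zero (p := (· ∈ I k ∪ J k))
        (fun i => l k i • (Q.A k (p₀ k).2.2).row i) ?_).trans ?_
      · intro i hi
        rw [Set.mem_union, not_or] at hi
        rw [hl k i hi.1 hi.2, zero_smul]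
      · rw [← h0, Matrix.mulVec_eq_sum]
        exact Finset.sum_congr rfl fun i _ => by simp [Matrix.row]
    by_cases hi : i ∈ I k ∪ J k
    · exact Fintype.linearIndependent_iff.mp (hli k) (fun i => l k i) hsum ⟨i, hi⟩
    · rw [Set.mem_union, not_or] at hi
      exact hl k i hi.1 hi.2
  have := hpos (fun k => (x k).ofLp) hI fun h0 => hx (by
    ext k e
    exact congrFun (congrFun h0 k) e)
  have e2 : ∑ k, (x k).ofLp ⬝ᵥ (Q.A k (p₀ k).2.2)ᵀ *ᵥ (l k).ofLp =
      -∑ k, (x k).ofLp ⬝ᵥ ∑ i, Q.block k (p₀ k).2.2 k i *ᵥ (x i).ofLp := by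
    rw [← Finset.sum_neg_distrib]
    refine Finset.sum_congr rfl fun k _ => ?_
    rw [← dotProduct_neg, ← eq_neg_of_add_eq_zero_right (hstat k)]
  rw [hinner, e2]
  linarith

theorem multiplierInclusion_injective (J : ∀ k, Set (Fin (m k)))
    {μ : EuclideanSpace ℝ (ConstraintIndex J)} (h : multiplierInclusion n J μ = 0) : μ = 0 := by
  ext ⟨⟨k, i⟩, hi⟩
  have : (if h : i ∈ J k then μ ⟨⟨k, i⟩, h⟩ else 0) = 0 :=
    congrArg (fun z : Profile n × Profile m => z.2 k i) h
  rwa [dif_pos hi] at this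

variable {x₀ : Profile n} {l₀ : Profile m}

theorem disjoint_I₁_I₂ (k : Fin N) :
    Disjoint (Q.toNEP.I₁ p₀ x₀ l₀ k) (Q.toNEP.I₂ p₀ x₀ l₀ k) := by
  refine Set.disjoint_left.mpr fun i h1 h2 => ?_
  rcases h1 with h1 | h1
  · exact absurd h2.1 (not_le.mpr h1)
  · exact h1.2.1.ne' h2.2.1

theorem SmoothAt.continuousAt_g (h : Q.SmoothAt fun k => (p₀ k).2.2) (k : Fin N) (i : Fin (m k)) :
    ContinuousAt (fun t : Param n m d × Profile n × Profile m =>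
      Q.toNEP.g k i (t.2.1 k) (t.1 k).2.2 - (t.1 k).1 i) (p₀, x₀, l₀) := by
  have hA : ∀ j, ContinuousAt (fun t : Param n m d × Profile n × Profile m =>
      Q.A k (t.1 k).2.2 i j) (p₀, x₀, l₀) := fun j =>
    ContinuousAt.comp (f := Prod.fst) (g := fun p : Param n m d => Q.A k (p k).2.2 i j)
      (h.contDiffAt_A k i j).continuousAt continuousAt_fst
  have hsum : ContinuousAt (fun t : Param n m d × Profile n × Profile m =>
      ∑ j, Q.A k (t.1 k).2.2 i j * t.2.1 k j) (p₀, x₀, l₀) :=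
    tendsto_finsetSum _ fun j _ => (hA j).mul (by fun_prop)
  exact (hsum.sub continuousAt_const).sub (by fun_prop)

/-- Near the reference point strongly active constraints keep positive multipliers and inactive
constraints stay inactive. -/
theorem eventually_activity (h : Q.SmoothAt fun k => (p₀ k).2.2)
    (hKKT : (x₀, l₀) ∈ Q.toNEP.SKKT p₀) :
    ∀ᶠ t : Param n m d × Profile n × Profile m in 𝓝 (p₀, x₀, l₀), ∀ k, ∀ i : Fin (m k),
      (i ∈ Q.toNEP.I₁ p₀ x₀ l₀ k → Q.s k ≤ (i : ℕ) → 0 < t.2.2 k i) ∧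
      (i ∉ Q.toNEP.I₁ p₀ x₀ l₀ k → i ∉ Q.toNEP.I₂ p₀ x₀ l₀ k →
        Q.toNEP.g k i (t.2.1 k) (t.1 k).2.2 - (t.1 k).1 i < 0) := by
  rw [eventually_all]
  intro k
  rw [eventually_all]
  intro i
  rw [mem_SKKT_iff] at hKKT
  refine Eventually.and ?_ ?_
  · simp only [eventually_imp_distrib_left]
    intro h1 h2
    have hc : ContinuousAt (fun t : Param n m d × Profile n × Profile m => t.2.2 k i)
      (p₀, x₀, l₀) := by fun_prop
    refine hc.eventually_const_lt ?_
    rcases h1 with h1 | h1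
    · exact absurd h2 (not_le.mpr h1)
    · exact h1.2.1
  · simp only [eventually_imp_distrib_left]
    intro h1 h2
    refine (h.continuousAt_g k i).eventually_lt_const ?_
    have hs : Q.s k ≤ (i : ℕ) := not_lt.mp fun hlt => h1 (Or.inl hlt)
    obtain ⟨a1, a2, a3⟩ := ((hKKT k).2 i).2 hs
    refine lt_of_le_of_ne a2 fun h0 => ?_
    rcases a1.eq_or_lt with h3 | h3
    · exact h2 ⟨hs, h3.symm, h0⟩
    · exact h1 (Or.inr ⟨hs, h3, h0⟩)

/-- As long as the activity of the constraints persists, the KKT system is equivalent to a mixed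
linear complementarity problem. -/
theorem mem_SKKT_iff_mixedLCP {p : Param n m d} {z : Profile n × Profile m}
    (hact : ∀ k, ∀ i : Fin (m k),
      (i ∈ Q.toNEP.I₁ p₀ x₀ l₀ k → Q.s k ≤ (i : ℕ) → 0 < z.2 k i) ∧
      (i ∉ Q.toNEP.I₁ p₀ x₀ l₀ k → i ∉ Q.toNEP.I₂ p₀ x₀ l₀ k →
        Q.toNEP.g k i (z.1 k) (p k).2.2 - (p k).1 i < 0)) :
    z ∈ Q.toNEP.SKKT p ↔ ∃ μ, Q.kktOperator (Q.toNEP.I₁ p₀ x₀ l₀) p z =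
      Q.kktRhs (Q.toNEP.I₁ p₀ x₀ l₀) p + multiplierInclusion n (Q.toNEP.I₂ p₀ x₀ l₀) μ ∧
      ∀ j, 0 ≤ μ j ∧
        0 ≤ (Q.constraintRhs (Q.toNEP.I₂ p₀ x₀ l₀) p -
          Q.constraintOperator (Q.toNEP.I₂ p₀ x₀ l₀) p z) j ∧
        μ j * (Q.constraintRhs (Q.toNEP.I₂ p₀ x₀ l₀) p -
          Q.constraintOperator (Q.toNEP.I₂ p₀ x₀ l₀) p z) j = 0 := by
  obtain ⟨x, l⟩ := z
  set I := Q.toNEP.I₁ p₀ x₀ l₀ with hI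
  set J := Q.toNEP.I₂ p₀ x₀ l₀ with hJ
  have hdisj : ∀ k, Disjoint (I k) (J k) := fun k => disjoint_I₁_I₂ k
  have hres : ∀ j : ConstraintIndex J,
      (Q.constraintRhs J p - Q.constraintOperator J p (x, l)) j =
        -(Q.toNEP.g j.1.1 j.1.2 (x j.1.1) (p j.1.1).2.2 - (p j.1.1).1 j.1.2) := by
    intro j
    change Q.b j.1.1 j.1.2 + (p j.1.1).1 j.1.2 -
      (Q.a j.1.1 j.1.2 (p j.1.1).2.2).ofLp ⬝ᵥ (x j.1.1).ofLp =
      -((Q.a j.1.1 j.1.2 (p j.1.1).2.2).ofLp ⬝ᵥ (x j.1.1).ofLp - Q.b j.1.1 j.1.2 -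
        (p j.1.1).1 j.1.2)
    ring
  have hstat : ∀ k, ((p k).2.1.ofLp =
      Q.gradObjective k x (p k).2.2 + (Q.A k (p k).2.2)ᵀ *ᵥ (l k).ofLp) ↔
      ∀ e, 1 / 2 * ((Q.P k (p k).2.2 + (Q.P k (p k).2.2)ᵀ) *ᵥ stack x) ⟨k, e⟩ +
            ((Q.A k (p k).2.2)ᵀ *ᵥ (l k).ofLp) e = Q.c k (p k).2.2 ⟨k, e⟩ + (p k).2.1 e := by
    intro k
    rw [funext_iff]
    refine forall_congr' fun e => ?_
    rw [Pi.add_apply, gradObjective]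
    constructor <;> intro h <;> linarith
  have hg : ∀ k i, Q.toNEP.g k i (x k) (p k).2.2 - (p k).1 i =
      Q.A k (p k).2.2 i ⬝ᵥ (x k).ofLp - (Q.b k i + (p k).1 i) := by
    intro k i
    change (Q.a k i (p k).2.2).ofLp ⬝ᵥ (x k).ofLp - Q.b k i - (p k).1 i =
      (Q.a k i (p k).2.2).ofLp ⬝ᵥ (x k).ofLp - (Q.b k i + (p k).1 i)
    ring
  have hsys : ∀ μ, Q.kktOperator I p (x, l) = Q.kktRhs I p + multiplierInclusion n J μ ↔
      ∀ k, (∀ e, 1 / 2 * ((Q.P k (p k).2.2 + (Q.P k (p k).2.2)ᵀ) *ᵥ stack x) ⟨k, e⟩ +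
            ((Q.A k (p k).2.2)ᵀ *ᵥ (l k).ofLp) e = Q.c k (p k).2.2 ⟨k, e⟩ + (p k).2.1 e) ∧
        ∀ i, (if i ∈ I k then Q.A k (p k).2.2 i ⬝ᵥ (x k).ofLp else l k i) =
          (if i ∈ I k then Q.b k i + (p k).1 i else 0) +
            if h : i ∈ J k then μ ⟨⟨k, i⟩, h⟩ else 0 := by
    intro μ
    constructor
    · intro h k
      exact ⟨fun e => (congrArg (fun z : Profile n × Profile m => z.1 k e) h).trans (add_zero _),
        fun i => congrArg (fun z : Profile n × Profile m => z.2 k i) h⟩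
    · intro h
      refine Prod.ext ?_ ?_
      · ext k e
        exact ((h k).1 e).trans (add_zero _).symm
      · ext k i
        exact (h k).2 i
  rw [mem_SKKT_iff]
  simp only [hsys, hres, hstat]
  constructor
  · intro h
    refine ⟨WithLp.toLp 2 fun j => l j.1.1 j.1.2, fun k => ⟨(h k).1, fun i => ?_⟩, fun j => ?_⟩
    · have hi := (h k).2 i
      by_cases h1 : i ∈ I k
      · rw [if_pos h1, if_pos h1, dif_neg (Set.disjoint_left.mp (hdisj k) h1), add_zero,
          ← sub_eq_zero, ← hg]
        rcases lt_or_ge (i : ℕ) (Q.s k) with hs | hs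
        · exact hi.1 hs
        · exact (mul_eq_zero.mp (hi.2 hs).2.2).resolve_left ((hact k i).1 h1 hs).ne'
      · rw [if_neg h1, if_neg h1, zero_add]
        by_cases h2 : i ∈ J k
        · rw [dif_pos h2]
        · rw [dif_neg h2]
          have hs : Q.s k ≤ (i : ℕ) := not_lt.mp fun hlt => h1 (Or.inl hlt)
          exact (mul_eq_zero.mp (hi.2 hs).2.2).resolve_right ((hact k i).2 h1 h2).ne
    · obtain ⟨a1, a2, a3⟩ := ((h j.1.1).2 j.1.2).2 j.2.1
      refine ⟨a1, neg_nonneg.mpr a2, ?_⟩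
      rw [mul_neg, neg_eq_zero]
      exact a3
  · rintro ⟨μ, h, hμ⟩ k
    refine ⟨(h k).1, fun i => ?_⟩
    have hi := (h k).2 i
    by_cases h1 : i ∈ I k
    · rw [if_pos h1, if_pos h1, dif_neg (Set.disjoint_left.mp (hdisj k) h1), add_zero,
          ← sub_eq_zero, ← hg] at hi
      refine ⟨fun _ => hi, fun hs => ⟨((hact k i).1 h1 hs).le, hi.le, ?_⟩⟩
      rw [hi, mul_zero]
    · have hs : Q.s k ≤ (i : ℕ) := not_lt.mp fun hlt => h1 (Or.inl hlt)
      rw [if_neg h1, if_neg h1, zero_add] at hi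
      refine ⟨fun hlt => absurd hs (not_le.mpr hlt), fun _ => ?_⟩
      by_cases h2 : i ∈ J k
      · rw [dif_pos h2] at hi
        obtain ⟨a1, a2, a3⟩ := hμ ⟨⟨k, i⟩, h2⟩
        rw [mul_neg, neg_eq_zero] at a3
        rw [hi]
        exact ⟨a1, neg_nonneg.mp a2, a3⟩
      · rw [dif_neg h2] at hi
        exact ⟨hi.ge, ((hact k i).2 h1 h2).le, by rw [hi, zero_mul]⟩

/-- Strong regularity of the KKT mapping when the active gradients are linearly independent and
the Jacobian of the game is positive definite on the critical subspaces. -/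
theorem stronglyRegular_SKKT (hsmooth : Q.SmoothAt fun k => (p₀ k).2.2)
    (hsymm : ∀ k, (Q.P k (p₀ k).2.2).IsSymm) (hKKT : (x₀, l₀) ∈ Q.toNEP.SKKT p₀)
    (hli : ∀ k, LinearIndependent ℝ
      (fun i : ↥(Q.toNEP.I₁ p₀ x₀ l₀ k ∪ Q.toNEP.I₂ p₀ x₀ l₀ k) => (Q.A k (p₀ k).2.2).row i))
    (hpos : ∀ y : ∀ k, Fin (n k) → ℝ, (∀ k, y k ∈ Q.M p₀ x₀ l₀ k) → y ≠ 0 →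
      0 < ∑ k, y k ⬝ᵥ ∑ i, Q.block k (p₀ k).2.2 k i *ᵥ y i) :
    StronglyRegular Q.toNEP.SKKT p₀ (x₀, l₀) := by
  -- One inequality serves both hypotheses of the mixed LCP: with `μ = 0` it makes the operator
  -- injective, with `μ ≠ 0` it is the required positivity.
  have hneg : ∀ (z : Profile n × Profile m) μ, Q.kktOperator (Q.toNEP.I₁ p₀ x₀ l₀) p₀ z =
      multiplierInclusion n (Q.toNEP.I₂ p₀ x₀ l₀) μ → z ≠ 0 →
      inner ℝ (Q.constraintOperator (Q.toNEP.I₂ p₀ x₀ l₀) p₀ z) μ < 0 := fun z μ h hz =>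
    inner_constraintOperator_neg disjoint_I₁_I₂ hsymm hli hpos h hz
  obtain ⟨U, hU, φ, K, hφ, hsol⟩ := exists_lipschitzOn_mixedLCP
    (multiplierInclusion n (Q.toNEP.I₂ p₀ x₀ l₀))
    (contDiffAt_kktOperator hsmooth (Q.toNEP.I₁ p₀ x₀ l₀))
    (contDiffAt_kktRhs hsmooth (Q.toNEP.I₁ p₀ x₀ l₀))
    (contDiffAt_constraintOperator hsmooth (Q.toNEP.I₂ p₀ x₀ l₀))
    (contDiffAt_constraintRhs (Q := Q) (p₀ := p₀) (Q.toNEP.I₂ p₀ x₀ l₀))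
    (fun z hz => by
      by_contra hne
      have := hneg z 0 (by rw [hz, map_zero]) hne
      rw [inner_zero_right] at this
      exact lt_irrefl _ this)
    (fun z μ h hμ => hneg z μ h fun hz => hμ (multiplierInclusion_injective _ (by
      rw [← h, hz, map_zero])))
  have hact := eventually_activity hsmooth hKKT
  have hφ₀ : (x₀, l₀) = φ p₀ := (hsol p₀ (mem_of_mem_nhds hU) (x₀, l₀)).mp
    ((mem_SKKT_iff_mixedLCP hact.self_of_nhds).mp hKKT)
  rw [nhds_prod_eq, eventually_prod_iff] at hact
  obtain ⟨PU, hPU, PV, hPV, hact⟩ := hact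
  have hcont : ContinuousAt φ p₀ := hφ.continuousOn.continuousAt hU
  -- The mixed LCP is equivalent to KKT only where activity persists, so `φ p` must itself remain in
  -- that neighborhood.
  have hφV : ∀ᶠ p in 𝓝 p₀, PV (φ p) := hcont.eventually (by rwa [← hφ₀])
  refine ⟨hKKT, U ∩ ({p | PU p} ∩ {p | PV (φ p)}), inter_mem hU (inter_mem hPU hφV),
    {z | PV z}, hPV, φ, K, hφ.mono Set.inter_subset_left, ?_⟩
  rintro p ⟨hpU, hp1, hp2⟩
  ext z
  rw [Set.mem_singleton_iff]
  constructor
  · rintro ⟨hz, hzV⟩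
    exact (hsol p hpU z).mp ((mem_SKKT_iff_mixedLCP (hact hp1 hzV)).mp hz)
  · rintro rfl
    exact ⟨(mem_SKKT_iff_mixedLCP (hact hp1 hp2)).mpr ((hsol p hpU _).mpr rfl), hp2⟩

end NashKKT.QPData

end Regularity

/-! ### KKT points near the reference point are local Nash equilibria. -/

noncomputable section LocalNash

open scoped Matrix Classical

/-- Finsler's lemma on a compact set. -/
theorem IsCompact.exists_forall_mul_add_pos {X : Type*} [TopologicalSpace X] {K : Set X}
    (hK : IsCompact K) {u v : X → ℝ} (hu : Continuous u) (hv : Continuous v) (hnn : ∀ x, 0 ≤ u x)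
    (h : ∀ x ∈ K, u x = 0 → 0 < v x) : ∃ C : ℝ, 0 ≤ C ∧ ∀ x ∈ K, 0 < C * u x + v x := by
  -- As `u ≥ 0`, these open sets increase with `c`; compactness leaves a single one covering `K`.
  obtain ⟨c, hc⟩ := hK.elim_directed_cover (fun c : ℕ => {x | 0 < c * u x + v x})
    (fun c => isOpen_lt continuous_const ((continuous_const.mul hu).add hv))
    (fun x hx => by
      rw [Set.mem_iUnion]
      rcases (hnn x).eq_or_lt with h0 | h0
      · refine ⟨0, ?_⟩
        simpa using h x hx h0.symm
      · obtain ⟨c, hc⟩ := exists_nat_gt (-v x / u x)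
        rw [div_lt_iff₀ h0] at hc
        exact ⟨c, by simp only [Set.mem_ofPred_eq]; linarith⟩)
    (Monotone.directed_le fun a b hab x hx => by
      simp only [Set.mem_ofPred_eq] at hx ⊢
      have : (a : ℝ) * u x ≤ b * u x := mul_le_mul_of_nonneg_right (by exact_mod_cast hab) (hnn x)
      linarith)
  exact ⟨c, c.cast_nonneg, fun x hx => hc hx⟩

namespace NashKKT.QPData

variable {N : ℕ} {n m d : Fin N → ℕ} {Q : QPData n m d} {p₀ : Param n m d} {x₀ : Profile n}
  {l₀ : Profile m}

theorem SmoothAt.continuousAt_row (hsmooth : Q.SmoothAt fun k => (p₀ k).2.2) (k : Fin N)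
    (i : Fin (m k)) (h₀ : E (n k)) : ContinuousAt (fun t : Param n m d × E (n k) =>
      Q.A k (t.1 k).2.2 i ⬝ᵥ t.2.ofLp) (p₀, h₀) := by
  have hA : ∀ j, ContinuousAt (fun t : Param n m d × E (n k) =>
      Q.A k (t.1 k).2.2 i j) (p₀, h₀) := fun j =>
    ContinuousAt.comp (f := Prod.fst) (g := fun p : Param n m d => Q.A k (p k).2.2 i j)
      (hsmooth.contDiffAt_A k i j).continuousAt continuousAt_fst
  simp only [dotProduct]
  exact tendsto_finsetSum _ fun j _ => (hA j).mul (by fun_prop)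

theorem SmoothAt.continuousAt_hessian (hsmooth : Q.SmoothAt fun k => (p₀ k).2.2) (k : Fin N)
    (h₀ : E (n k)) : ContinuousAt (fun t : Param n m d × E (n k) =>
      t.2.ofLp ⬝ᵥ Q.block k (t.1 k).2.2 k k *ᵥ t.2.ofLp) (p₀, h₀) := by
  have hB : ∀ j j', ContinuousAt (fun t : Param n m d × E (n k) =>
      Q.block k (t.1 k).2.2 k k j j') (p₀, h₀) := fun j j' =>
    ContinuousAt.comp (f := Prod.fst)
      (g := fun p : Param n m d => Q.P k (p k).2.2 ⟨k, j⟩ ⟨k, j'⟩)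
      (hsmooth.contDiffAt_P k _ _).continuousAt continuousAt_fst
  simp only [dotProduct, Matrix.mulVec]
  exact tendsto_finsetSum _ fun j _ => ContinuousAt.mul (by fun_prop)
    (tendsto_finsetSum _ fun j' _ => (hB j j').mul (by fun_prop))

variable (Q) in
/-- The Hessian of player `k` plus `C` times the sum of the squared constraint gradients in `I`,
as a quadratic form. -/
def augmentedHessian (k : Fin N) (I : Set (Fin (m k))) (C : ℝ) (w : E (d k)) (h : E (n k)) : ℝ :=
  C * ∑ i with i ∈ I, (Q.A k w i ⬝ᵥ h.ofLp) ^ 2 + h.ofLp ⬝ᵥ Q.block k w k k *ᵥ h.ofLp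

theorem augmentedHessian_smul (k : Fin N) (I : Set (Fin (m k))) (C : ℝ) (w : E (d k)) (t : ℝ)
    (h : E (n k)) : Q.augmentedHessian k I C w (t • h) = t ^ 2 * Q.augmentedHessian k I C w h := by
  simp only [augmentedHessian, WithLp.ofLp_smul, dotProduct_smul, smul_dotProduct,
    Matrix.mulVec_smul, smul_eq_mul, mul_pow, ← Finset.mul_sum]
  ring

theorem augmentedHessian_nonneg {k : Fin N} {I : Set (Fin (m k))} {C : ℝ} {w : E (d k)}
    (hpos : ∀ h ∈ Metric.sphere (0 : E (n k)) 1, 0 < Q.augmentedHessian k I C w h) (h : E (n k)) :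
    0 ≤ Q.augmentedHessian k I C w h := by
  rcases eq_or_ne h 0 with rfl | hne
  · simp [augmentedHessian]
  have hn : ‖h‖ ≠ 0 := norm_ne_zero_iff.mpr hne
  have hmem : ‖h‖⁻¹ • h ∈ Metric.sphere (0 : E (n k)) 1 := by simp [norm_smul, hn]
  have e : h = ‖h‖ • (‖h‖⁻¹ • h) := by rw [smul_smul, mul_inv_cancel₀ hn, one_smul]
  rw [e, augmentedHessian_smul]
  exact mul_nonneg (sq_nonneg _) (hpos _ hmem).le

theorem SmoothAt.continuousAt_augmentedHessian (hsmooth : Q.SmoothAt fun k => (p₀ k).2.2)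
    (k : Fin N) (I : Set (Fin (m k))) (C : ℝ) (h₀ : E (n k)) :
    ContinuousAt (fun t : Param n m d × E (n k) => Q.augmentedHessian k I C (t.1 k).2.2 t.2)
      (p₀, h₀) := by
  simp only [augmentedHessian]
  exact (continuousAt_const.mul
    (tendsto_finsetSum _ fun i _ => (hsmooth.continuousAt_row k i h₀).pow 2)).add
    (hsmooth.continuousAt_hessian k h₀)

theorem exists_augmentedHessian_pos (k : Fin N) {I : Set (Fin (m k))} {w : E (d k)}
    (hpos : ∀ y : Fin (n k) → ℝ, (∀ i ∈ I, Q.A k w i ⬝ᵥ y = 0) → y ≠ 0 →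
      0 < y ⬝ᵥ Q.block k w k k *ᵥ y) :
    ∃ C : ℝ, 0 ≤ C ∧ ∀ h ∈ Metric.sphere (0 : E (n k)) 1, 0 < Q.augmentedHessian k I C w h := by
  refine (isCompact_sphere (0 : E (n k)) 1).exists_forall_mul_add_pos
    (u := fun h => ∑ i with i ∈ I, (Q.A k w i ⬝ᵥ h.ofLp) ^ 2)
    (v := fun h => h.ofLp ⬝ᵥ Q.block k w k k *ᵥ h.ofLp)
    (by simp only [dotProduct]; fun_prop)
    (by simp only [dotProduct, Matrix.mulVec]; fun_prop)
    (fun h => Finset.sum_nonneg fun i _ => sq_nonneg _)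
    (fun h hh h0 => hpos h.ofLp (fun i hi => ?_) fun hz => ?_)
  · have := (Finset.sum_eq_zero_iff_of_nonneg fun i _ => sq_nonneg _).mp h0 i (by simpa using hi)
    exact (pow_eq_zero_iff two_ne_zero).mp this
  · have : h = 0 := WithLp.ofLp_injective 2 hz
    rw [this] at hh
    simp at hh

/-- The augmented Hessian of player `k` is positive semidefinite near a parameter at which the
Hessian is positive definite on the critical subspace. -/
theorem exists_eventually_augmentedHessian_nonneg (hsmooth : Q.SmoothAt fun k => (p₀ k).2.2)
    (k : Fin N) {I : Set (Fin (m k))}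
    (hpos : ∀ y : Fin (n k) → ℝ, (∀ i ∈ I, Q.A k (p₀ k).2.2 i ⬝ᵥ y = 0) → y ≠ 0 →
      0 < y ⬝ᵥ Q.block k (p₀ k).2.2 k k *ᵥ y) :
    ∃ C : ℝ, 0 ≤ C ∧ ∀ᶠ p : Param n m d in 𝓝 p₀, ∀ h : E (n k),
      0 ≤ Q.augmentedHessian k I C (p k).2.2 h := by
  obtain ⟨C, hC, hCpos⟩ := exists_augmentedHessian_pos k hpos
  refine ⟨C, hC, ?_⟩
  -- Compactness of the sphere yields one parameter neighborhood for all directions; homogeneity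
  -- then removes the normalization.
  have hev := (isCompact_sphere (0 : E (n k)) 1).eventually_forall_of_forall_eventually (x₀ := p₀)
    (P := fun p h => 0 < Q.augmentedHessian k I C (p k).2.2 h)
    (fun h₀ hh₀ => (hsmooth.continuousAt_augmentedHessian k I C h₀).tendsto.eventually_const_lt
      (hCpos h₀ hh₀))
  exact hev.mono fun p hp => augmentedHessian_nonneg hp

/-- KKT points near the reference point are local Nash equilibria, provided that the own Hessian
of each player is positive definite on the critical subspace. -/
theorem eventually_isLNE (hsmooth : Q.SmoothAt fun k => (p₀ k).2.2)
    (hKKT : (x₀, l₀) ∈ Q.toNEP.SKKT p₀)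
    (hpos : ∀ k, ∀ y ∈ Q.M p₀ x₀ l₀ k, y ≠ 0 → 0 < y ⬝ᵥ Q.block k (p₀ k).2.2 k k *ᵥ y) :
    ∀ᶠ z : Param n m d × Profile n × Profile m in 𝓝 (p₀, x₀, l₀),
      z.2 ∈ Q.toNEP.SKKT z.1 → Q.toNEP.IsLNE z.1 z.2.1 := by
  choose C hC hCpos using fun k => exists_eventually_augmentedHessian_nonneg hsmooth k (hpos k)
  have hfst : Tendsto (Prod.fst : Param n m d × Profile n × Profile m → _) (𝓝 (p₀, x₀, l₀))
    (𝓝 p₀) := continuousAt_fst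
  filter_upwards [eventually_activity hsmooth hKKT, hfst.eventually (eventually_all.mpr hCpos)]
  rintro ⟨p, x, l⟩ hact haug hz k
  rw [mem_SKKT_iff] at hz
  obtain ⟨hstat, hcon⟩ := hz k
  set w := (p k).2.2 with hw
  refine ⟨⟨fun i hi => sub_eq_zero.mp ((hcon i).1 hi),
    fun i hi => sub_nonpos.mp ((hcon i).2 hi).2.1⟩, ?_⟩
  -- For feasible `x k + h` and `l k i > 0`, the product `t` of row `i` with `h` is `≤ 0`, so `|C k
  -- / 2 * t| < l k i` gives `C k / 2 * t ^ 2 ≤ -(l k i * t)`.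
  have hsmall : ∀ᶠ y in 𝓝[Q.toNEP.feasible p k] (x k), ∀ i, 0 < l k i →
      |C k / 2 * (Q.A k w i ⬝ᵥ (y - x k).ofLp)| < l k i := by
    refine Eventually.filter_mono nhdsWithin_le_nhds ?_
    rw [eventually_all]
    intro i
    by_cases hl : 0 < l k i
    · have hc : ContinuousAt (fun y : E (n k) => |C k / 2 * (Q.A k w i ⬝ᵥ (y - x k).ofLp)|)
          (x k) := by
        simp only [dotProduct]
        fun_prop
      refine (hc.eventually_lt_const ?_).mono fun y hy _ => hy
      simpa using hl
    · exact Eventually.of_forall fun y h => absurd h hl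
  filter_upwards [hsmall, self_mem_nhdsWithin] with y hy hfeas
  obtain ⟨h, rfl⟩ : ∃ h, y = x k + h := ⟨y - x k, by abel⟩
  simp only [add_sub_cancel_left] at hy
  have hg : ∀ i, Q.toNEP.g k i (x k + h) w - (p k).1 i =
      (Q.toNEP.g k i (x k) w - (p k).1 i) + Q.A k w i ⬝ᵥ h.ofLp := by
    intro i
    have e : Q.A k w i = (Q.a k i w).ofLp := rfl
    simp only [toNEP, e, WithLp.ofLp_add, dotProduct_add]
    ring
  have hterm : ∀ i, C k / 2 * (if i ∈ Q.toNEP.I₁ p₀ x₀ l₀ k then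
      (Q.A k w i ⬝ᵥ h.ofLp) ^ 2 else 0) ≤ -(l k i * (Q.A k w i ⬝ᵥ h.ofLp)) := by
    intro i
    set t := Q.A k w i ⬝ᵥ h.ofLp with ht
    rcases lt_or_ge (i : ℕ) (Q.s k) with hs | hs
    · have h1 := (hcon i).1 hs
      have h2 := sub_eq_zero.mpr (hfeas.1 i hs)
      rw [hg i, h1, zero_add] at h2
      rw [ht, h2]
      simp
    · obtain ⟨a1, a2, a3⟩ := (hcon i).2 hs
      have h2 := sub_nonpos.mpr (hfeas.2 i hs)
      rw [hg i] at h2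
      rcases a1.eq_or_lt with h0 | h0
      -- A zero multiplier rules out membership in `I₁`, so there is no penalty to absorb.
      · rw [if_neg fun hi => ((hact k i).1 hi hs).ne h0, ← h0]
        simp
      · rw [(mul_eq_zero.mp a3).resolve_left h0.ne', zero_add] at h2
        have h3 := (abs_lt.mp (hy i h0)).1
        have h4 : C k / 2 * t ^ 2 ≤ -(l k i * t) := by nlinarith
        split_ifs
        · exact h4
        · nlinarith
  have hsum := Finset.sum_le_sum fun i (_ : i ∈ Finset.univ) => hterm i
  rw [← Finset.mul_sum, ← Finset.sum_filter, Finset.sum_neg_distrib] at hsum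
  have hgrad : ((Q.A k w)ᵀ *ᵥ (l k).ofLp) ⬝ᵥ h.ofLp = ∑ i, l k i * (Q.A k w i ⬝ᵥ h.ofLp) := by
    rw [Matrix.mulVec_transpose, ← Matrix.dotProduct_mulVec]
    rfl
  have hinner : inner ℝ (p k).2.1 h =
      Q.gradObjective k x w ⬝ᵥ h.ofLp + ∑ i, l k i * (Q.A k w i ⬝ᵥ h.ofLp) := by
    rw [EuclideanSpace.inner_eq_star_dotProduct, star_trivial, dotProduct_comm, hstat,
      add_dotProduct, hgrad]
  have := haug k h
  rw [augmentedHessian] at this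
  simp only [NEP.playerObjective, Function.update_eq_self]
  rw [f_update_add, inner_add_right, hinner]
  -- The objective gain is `½ h ⬝ᵥ P h - ∑ l k i * t i`, where `P` is the own block and `t i` the
  -- product of row `i` with `h`. By `hsum` it is at least half the augmented Hessian at `h`, hence
  -- nonnegative.
  linarith

end NashKKT.QPData

end LocalNash

theorem mainTheorem11 {N : ℕ} (n m d r : Fin N → ℕ) (Q : QPData n m d)
    (p₀ : Param n m d) (x₀ : Profile n) (l₀ : Profile m)
    -- the data are continuously differentiable around the reference parameter, and each matrix
    -- `P^k` is symmetric there
    (hsmooth : Q.SmoothAt (fun k => (p₀ k).2.2))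
    (hsymm : ∀ k, (Q.P k (p₀ k).2.2).IsSymm)
    -- the reference KKT point
    (hKKT : (x₀, l₀) ∈ Q.toNEP.SKKT p₀)
    -- the columns of `B^k` form a basis of `M^k`
    (B : ∀ k, Matrix (Fin (n k)) (Fin (r k)) ℝ)
    (hBind : ∀ k, LinearIndependent ℝ (B k).col)
    (hBspan : ∀ k, Submodule.span ℝ (Set.range (B k).col) = Q.M p₀ x₀ l₀ k)
    -- (i) the active rows are linearly independent
    (h1 : ∀ k, LinearIndependent ℝ
      (fun i : ↥(Q.toNEP.I₁ p₀ x₀ l₀ k ∪ Q.toNEP.I₂ p₀ x₀ l₀ k) => (Q.A k (p₀ k).2.2).row i))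
    -- (ii) `P^k_{n_k n_k}` is positive definite on `M^k`
    (h2 : ∀ k, ∀ y ∈ Q.M p₀ x₀ l₀ k, y ≠ 0 →
      0 < y ⬝ᵥ (Q.block k (p₀ k).2.2 k k).mulVec y)
    -- (iii) the weighted Schur complement condition (void for a single player)
    (h3 : ∃ α : Fin N → Fin N → ℝ,
      (∀ i j, j ≠ i → 0 < α i j) ∧
      (2 ≤ N → ∀ i, ∑ j ∈ Finset.univ.filter (fun j => j ≠ i), α i j = 1) ∧
      ∀ i k, i ≠ k → ∀ y ∈ Q.M p₀ x₀ l₀ k, y ≠ 0 →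
        0 < y ⬝ᵥ (Q.block k (p₀ k).2.2 k k -
          (1 / (4 * α i k * α k i)) •
            ((Q.T (fun k => (p₀ k).2.2) i k).transpose * B i *
              ((B i).transpose * Q.block i (p₀ i).2.2 i i * B i)⁻¹ *
              (B i).transpose * Q.T (fun k => (p₀ k).2.2) i k)).mulVec y) :
    StronglyRegular Q.toNEP.SKKT p₀ (x₀, l₀) ∧
      ∀ᶠ z : Param n m d × Profile n × Profile m in nhds (p₀, x₀, l₀),
        z.2 ∈ Q.toNEP.SKKT z.1 → Q.toNEP.IsLNE z.1 z.2.1 := by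
  have hpd : ∀ y : ∀ k, Fin (n k) → ℝ, (∀ k, y k ∈ Q.M p₀ x₀ l₀ k) → y ≠ 0 →
      0 < ∑ k, y k ⬝ᵥ ∑ i, (Q.block k (p₀ k).2.2 k i).mulVec (y i) := by
    obtain ⟨α, hα, hsum, hschur⟩ := h3
    intro y hy hne
    exact sum_dotProduct_mulVec_pos (H := fun k i => Q.block k (p₀ k).2.2 k i)
      (fun k => (hsymm k).submatrix _) hBind hBspan h2 hα hsum hschur hy hne
  exact ⟨QPData.stronglyRegular_SKKT hsmooth hsymm hKKT h1 hpd,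
    QPData.eventually_isLNE hsmooth hKKT h2⟩
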